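/- Let $\mathcal X$ be a (finite-dimensional, second countable) Riemannian manifold with distance $\mathrm{dist}$ and balls $B_\delta(\zeta)=\{x:\mathrm{dist}(x,\zeta)<\delta\}$, let $f:\mathcal X\to\mathcal X$ be Borel measurable, and let $\phi:\mathcal X\to\mathbb R$ be continuous; write $S_p\phi=\sum_{i=0}^{p-1}\phi\circ f^i$. Assume that the pressure $P(\phi)=\sup\{h(\nu)+\int\phi\,d\nu:\ \nu \text{ an } f\text{-invariant Borel probability},\ -\int\phi\,d\nu<\infty\}$ is $0$ ($h$ = metric entropy), that $m$ is a $\phi$-conformal probability measure (i.e. $m(f(A))=\int_A e^{-\phi}\,dm$ for every Borel $A$ on which $f$ is injective), and that $\mu\ll m$ is an equilibrium state for $\phi$ (an $f$-invariant probability with $-\int\phi\,d\mu<\infty$ and $h(\mu)+\int\phi\,d\mu=P(\phi)$). Let $\zeta$ be a repelling periodic point of $f$ of prime period $p\ge1$: $f$ is differentiable at the points of the orbit of $\zeta$, $f^p$ coincides near $\zeta$ with a homeomorphism between open neighbourhoods of $\zeta$, and $\|D(f^p)(\zeta)v\|\ge\kappa\|v\|$ for all tangent vectors $v$ at $\zeta$,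 for some $\kappa>1$. Assume that $\zeta$ lies in the support of $m$ and is a Lebesgue density point of $d\mu/dm$ with value $0<c=\frac{d\mu}{dm}(\zeta)<\infty$, i.e. $\frac1{m(B_r(\zeta))}\int_{B_r(\zeta)}\left|\frac{d\mu}{dm}-c\right|dm\to0$ as $r\to0^+$, and that $\eta\mapsto\mu(B_\eta(\zeta))$ is continuous for small $\eta\ge0$. Let $X_n=\varphi\circ f^n$ with $\varphi(x)=g(\mu(B_{\mathrm{dist}(x,\zeta)}(\zeta)))$, where $g:[0,\infty)\to\mathbb R\cup\{\pm\infty\}$ restricts, for some $v>0$ and $w<g(0)$, to a strictly decreasing bijection $[0,v)\to(w,g(0)]$, and $g\le w$ on $[v,\infty)$. Let $u_F=\sup\{x\in\mathbb R:\mu(X_0\le x)<1\}$ and assume that for all $u<u_F$ sufficiently close to $u_F$ $$\sum_{j=0}^\infty\sup\{|S_p\phi(x)-S_p\phi(\zeta)|:\ x\in\{\varphi>u\}\cap f^{-jp}(\{\varphi>u\})\}<\infty .$$ Let $(u_n)$ be real numbers with $n\,\mu(X_0>u_n)\to\tau$ for some $\tau>0$. Put $Q_{i}(u)=\{X_i>u,\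 X_{i+p}\le u\}$ and $\mathscr Q_{s,\ell}(u)=\bigcap_{i=s}^{s+\ell-1}Q_{i}(u)^c$, and assume that there are non-negative integers $t_n=o(n)$ such that: ($D^p(u_n)$) there is $\gamma(n,t)$, nonincreasing in $t$ for each $n$, with $n\gamma(n,t_n)\to0$ and $|\mu(Q_0(u_n)\cap\mathscr Q_{t,\ell}(u_n))-\mu(Q_0(u_n))\mu(\mathscr Q_{0,\ell}(u_n))|\le\gamma(n,t)$ for all non-negative integers $\ell,t,n$; ($D'_p(u_n)$) there are integers $k_n\to\infty$ with $k_nt_n=o(n)$ and $n\sum_{j=1}^{\lfloor n/k_n\rfloor}\mu(Q_0(u_n)\cap Q_j(u_n))\to0$. Let $\theta=1-e^{S_p\phi(\zeta)}$ and, for a Borel set $A$, let $r_A(x)=\min\{j\ge1:f^j(x)\in A\}$ (with $\min\emptyset=\infty$) and $\mu_A=\mu(\,\cdot\cap A)/\mu(A)$. Then for every sequence $\delta_n>0$ with $\delta_n\to0$, $$\lim_{n\to\infty}\mu\left(r_{B_{\delta_n}(\zeta)}<\frac t{\mu(B_{\delta_n}(\zeta))}\right)=1-e^{-\theta t}\qquad\text{for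 all }t\ge0,$$ $$\lim_{n\to\infty}\mu_{B_{\delta_n}(\zeta)}\left(r_{B_{\delta_n}(\zeta)}<\frac t{\mu(B_{\delta_n}(\zeta))}\right)=(1-\theta)+\theta(1-e^{-\theta t})\qquad\text{for all }t>0.$$ -/

import Mathlib

open MeasureTheory Filter Topology Set
open scoped ENNReal NNReal

noncomputable section

namespace EquilibriumHTS

/-! ### Thermodynamic formalism -/

section Thermodynamics

variable {M : Type*} [MeasurableSpace M]

/-- Shannon entropy of the join `⋁_{i<n} f^{-i} 𝒫`, where the finite partition `𝒫` is the partition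
into the fibres of `ξ : M → Fin k`. -/
def joinEntropy (f : M → M) (ν : Measure M) {k : ℕ} (ξ : M → Fin k) (n : ℕ) : ℝ :=
  ∑ w : Fin n → Fin k, Real.negMulLog (ν.real {x | ∀ i : Fin n, ξ (f^[i] x) = w i})

/-- Kolmogorov–Sinai (metric) entropy of `ν`: the supremum over finite measurable partitions of the
exponential growth rate of the entropies of the joins. -/
def metricEntropy (f : M → M) (ν : Measure M) : ℝ≥0∞ :=
  ⨆ (k : ℕ) (ξ : M → Fin k) (_ : Measurable ξ),
    limsup (fun n : ℕ => ENNReal.ofReal (joinEntropy f ν ξ n / n)) atTop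

/-- `∫ φ dν` as an extended real number, meaningful when the negative part is integrable. -/
def extIntegral (φ : M → ℝ) (ν : Measure M) : EReal :=
  ((∫⁻ x, ENNReal.ofReal (φ x) ∂ν : ℝ≥0∞) : EReal)
    - ((∫⁻ x, ENNReal.ofReal (-φ x) ∂ν : ℝ≥0∞) : EReal)

/-- `ν` is an `f`-invariant probability measure with `-∫ φ dν < ∞`. -/
structure IsAdmissible (f : M → M) (φ : M → ℝ) (ν : Measure M) : Prop where
  prob : IsProbabilityMeasure ν
  invariant : MeasurePreserving f ν ν
  neg_finite : ∫⁻ x, ENNReal.ofReal (-φ x) ∂ν < ⊤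

/-- The pressure `P(φ) = sup {h(ν) + ∫ φ dν}`. -/
def pressure (f : M → M) (φ : M → ℝ) : EReal :=
  ⨆ (ν : Measure M) (_ : IsAdmissible f φ ν), (metricEntropy f ν : EReal) + extIntegral φ ν

/-- `μ` is an equilibrium state for `(M, f, φ)`. -/
structure IsEquilibriumState (f : M → M) (φ : M → ℝ) (μ : Measure M) : Prop
    extends IsAdmissible f φ μ where
  eq_pressure : (metricEntropy f μ : EReal) + extIntegral φ μ = pressure f φ

/-- `m` is a `φ`-conformal measure. -/
structure IsConformal (f : M → M) (φ : M → ℝ) (m : Measure M) : Prop where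
  prob : IsProbabilityMeasure m
  conformal : ∀ A : Set M, MeasurableSet A → InjOn f A →
    m (f '' A) = ∫⁻ x in A, ENNReal.ofReal (Real.exp (-φ x)) ∂m

end Thermodynamics

/-! ### Local hypotheses at the point `ζ` -/

section Local

variable {M : Type*} [MetricSpace M] [MeasurableSpace M]

/-- `ζ` belongs to the support of `m` and is a Lebesgue point of `dμ/dm`, with value
`(dμ/dm)(ζ) = c`. -/
def HasDensityAt (μ m : Measure M) (ζ : M) (c : ℝ) : Prop :=
  (∀ r > 0, 0 < m (Metric.ball ζ r)) ∧
    Tendsto (fun r : ℝ => ⨍ x in Metric.ball ζ r, |(μ.rnDeriv m x).toReal - c| ∂m)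
      (𝓝[>] 0) (𝓝 0)

/-- The function `η ↦ μ(B_η(ζ))` is continuous for small `η ≥ 0`. -/
def ContinuousBallMeasure (μ : Measure M) (ζ : M) : Prop :=
  ∃ η₀ > 0, ContinuousOn (fun η : ℝ => μ.real (Metric.ball ζ η)) (Ico 0 η₀)

/-- The observable `x ↦ g (μ (B_{dist(x,ζ)}(ζ)))`. -/
def observable (μ : Measure M) (ζ : M) (g : ℝ≥0 → EReal) (x : M) : EReal :=
  g (μ (Metric.ball ζ (dist x ζ))).toNNReal

end Local

/-- `g` has a global maximum at `0`, it is a strictly decreasing bijection from a neighbourhood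
`[0, v)` of `0` onto a one-sided neighbourhood `(w, g 0]` of `g 0`, and it stays away from its
maximum outside `[0, v)`. -/
def IsPeakFunction (g : ℝ≥0 → EReal) : Prop :=
  ∃ v > 0, ∃ w < g 0, StrictAntiOn g (Iio v) ∧ BijOn g (Iio v) (Ioc w (g 0)) ∧
    ∀ y, v ≤ y → g y ≤ w

section Repelling

open Bundle Manifold

variable {E : Type*} [NormedAddCommGroup E] [NormedSpace ℝ E]
  {H : Type*} [TopologicalSpace H] (I : ModelWithCorners ℝ E H)
  {M : Type*} [MetricSpace M] [ChartedSpace H M]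
  [RiemannianBundle (fun x : M => TangentSpace I x)]

/-- `ζ` is a repelling periodic point of `f` of prime period `p`: `f` is differentiable along the
orbit, `f^p` has a local inverse branch at `ζ` (it coincides near `ζ` with a homeomorphism between
open neighbourhoods of `ζ`), and `D(f^p)(ζ)` expands the Riemannian norm, that is, the inverse
branch contracts. -/
structure IsRepellingPeriodicPoint (f : M → M) (ζ : M) (p : ℕ) : Prop where
  pos : 0 < p
  period : Function.minimalPeriod f ζ = p
  differentiable : ∀ j < p, MDifferentiableAt I I f (f^[j] ζ)
  localInverse : ∃ e : OpenPartialHomeomorph M M, ζ ∈ e.source ∧ EqOn (f^[p]) e e.source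
  expanding : ∃ κ : ℝ, 1 < κ ∧ ∀ v : TangentSpace I ζ, κ * ‖v‖ ≤ ‖mfderiv I I (f^[p]) ζ v‖

end Repelling

/-! ### The stationary process `X_n = X ∘ f^n` and its conditions -/

section StationaryEvents

variable {M : Type*}

/-- The exceedance event `{X_i > u}`. -/
def exceed (f : M → M) (X : M → EReal) (u : ℝ) (i : ℕ) : Set M :=
  {x | (u : EReal) < X (f^[i] x)}

/-- The escape event `Q_{p,i}(u) = {X_i > u, X_{i+p} ≤ u}`. -/
def escape (f : M → M) (X : M → EReal) (p : ℕ) (u : ℝ) (i : ℕ) : Set M :=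
  {x | (u : EReal) < X (f^[i] x) ∧ X (f^[i + p] x) ≤ u}

/-- No escape between the times `s` and `s + ℓ - 1`: the event `𝒬_{p,s,ℓ}(u)`. -/
def noEscape (f : M → M) (X : M → EReal) (p : ℕ) (u : ℝ) (s ℓ : ℕ) : Set M :=
  {x | ∀ i, s ≤ i → i < s + ℓ → x ∉ escape f X p u i}

variable [MeasurableSpace M]

/-- Condition `D^p(u_n)`, with the sequence `t_n = o(n)` it provides displayed. -/
def CondD (μ : Measure M) (f : M → M) (X : M → EReal) (p : ℕ) (u : ℕ → ℝ) (t : ℕ → ℕ) : Prop :=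
  (fun n => (t n : ℝ)) =o[atTop] (fun n : ℕ => (n : ℝ)) ∧
    ∃ γ : ℕ → ℕ → ℝ, (∀ n, Antitone (γ n)) ∧
      Tendsto (fun n : ℕ => (n : ℝ) * γ n (t n)) atTop (𝓝 0) ∧
      ∀ ℓ s n : ℕ,
        |μ.real (escape f X p (u n) 0 ∩ noEscape f X p (u n) s ℓ)
          - μ.real (escape f X p (u n) 0) * μ.real (noEscape f X p (u n) 0 ℓ)| ≤ γ n s

/-- Condition `D'_p(u_n)`, relative to the sequence `t_n` of `D^p(u_n)`. -/
def CondDPrime (μ : Measure M) (f : M → M) (X : M → EReal) (p : ℕ) (u : ℕ → ℝ) (t : ℕ → ℕ) : Prop :=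
  ∃ k : ℕ → ℕ, Tendsto k atTop atTop ∧
    (fun n => (k n : ℝ) * (t n : ℝ)) =o[atTop] (fun n : ℕ => (n : ℝ)) ∧
    Tendsto (fun n : ℕ => (n : ℝ) * ∑ j ∈ Finset.Icc 1 (n / k n),
      μ.real (escape f X p (u n) 0 ∩ escape f X p (u n) j)) atTop (𝓝 0)

/-- The right endpoint `u_F = sup {x : F(x) < 1}` of the distribution function
`F(x) = μ(X ≤ x)`. -/
def rightEndpoint (μ : Measure M) (X : M → EReal) : EReal :=
  sSup ((fun x : ℝ => (x : EReal)) '' {x : ℝ | μ {y | X y ≤ (x : EReal)} < 1})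

/-- The distortion condition: for all `u` sufficiently close to `u_F` (from below),
`∑_j sup {|S_p φ(x) - S_p φ(ζ)| : x ∈ {X > u} ∩ f^{-jp} {X > u}} < ∞`. -/
def SummableDistortion (μ : Measure M) (f : M → M) (φ : M → ℝ) (X : M → EReal) (p : ℕ) (ζ : M) :
    Prop :=
  ∃ a < rightEndpoint μ X, ∀ u : ℝ, a < (u : EReal) → (u : EReal) < rightEndpoint μ X →
    ∑' j : ℕ, (⨆ x ∈ exceed f X u 0 ∩ exceed f X u (j * p),
      ENNReal.ofReal |birkhoffSum f φ p x - birkhoffSum f φ p ζ|) < ⊤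

end StationaryEvents

/-- The first hitting (or return) time `r_A(x) = min {j ≥ 1 : f^j(x) ∈ A}`, `∞` if there is none. -/
def hittingTime {M : Type*} (f : M → M) (A : Set M) (x : M) : ℕ∞ :=
  ⨅ (j : ℕ) (_ : 1 ≤ j ∧ f^[j] x ∈ A), (j : ℕ∞)

/-- The event `{r_A < t / μ(A)}`. -/
def hitBefore {M : Type*} [MeasurableSpace M] (μ : Measure M) (f : M → M) (A : Set M) (t : ℝ) :
    Set M :=
  {x | ((hittingTime f A x : ℕ∞) : ℝ≥0∞) < ENNReal.ofReal t / μ A}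

end EquilibriumHTS

end

open EquilibriumHTS Bundle

/-! Write B for a small ball at `ζ`. Expansion of `f^p` at `ζ` says that the local inverse branch
does not increase the distance to `ζ`, so `f^p` maps B ∩ f^{-p}B bijectively onto B. Conformality
then gives m(B) = ∫ e^{-S_pφ} dm over B ∩ f^{-p}B, and continuity of S_pφ at `ζ` makes m(B ∩
f^{-p}B)/m(B) tend to e^{S_pφ(ζ)} = 1 - θ. At a Lebesgue point with positive density the same limit
holds for μ (`tendsto_return_ratio`).

The sets {X_0 > u_n} are eventually balls U_n (`exists_exceed_eq_ball`), so the escape sets Q_n =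
U_n \ f^{-p}U_n satisfy n μ(Q_n) → θτ. Unlike U_n, they do not cluster: D^p and D'_p allow time to
be cut into blocks separated by gaps, each block multiplying the probability of avoiding Q_n by
about 1 - b μ(Q_n), with b the block length. Hence avoiding Q_n for N steps has probability close to
exp(-θτN/n) (`measureReal_avoid_block`, `tendsto_avoid`). Avoiding Q_n differs from avoiding U_n by
at most p μ(U_n), since an orbit that enters U_n and does not escape is still there at the end.

An arbitrary ball of radius δ_j is compared with the exceedance ball of index n_j ≈ τ/μ(B_{δ_j}(ζ)):
the two are nested and their measures are asymptotically equal (`tendsto_avoid_ball`). This gives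
the hitting law. For the return law, invariance makes the measure of B ∩ {no return up to time k} a
discrete derivative of the hitting tail. It is monotone in k, so convergence of the tails forces
convergence of these derivatives (`tendsto_cond_hitBefore`). -/

namespace EquilibriumHTS

/-! ### Riemannian distance against the norm in a chart, and expansion near a fixed derivative -/

section RiemannianComparison

open Manifold

variable
    {E : Type*} [NormedAddCommGroup E] [NormedSpace ℝ E]
    {H : Type*} [TopologicalSpace H] (I : ModelWithCorners ℝ E H)
    {M : Type*} [MetricSpace M]
    [ChartedSpace H M] [IsManifold I 1 M]

/-- Vectors of the model space, read as tangent vectors at `x` through the preferred chart. -/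
noncomputable def chartTangent (x : M) : E ≃L[ℝ] TangentSpace I x :=
  ((trivializationAt E (TangentSpace I) x).continuousLinearEquivAt ℝ x
    (FiberBundle.mem_baseSet_trivializationAt' x)).symm


theorem chartTangent_apply (x : M) (w : E) :
    chartTangent I x w = (trivializationAt E (TangentSpace I) x).symmL ℝ x w :=
  congrFun (Trivialization.symm_continuousLinearEquivAt_eq (R := ℝ)
    (trivializationAt E (TangentSpace I) x) (FiberBundle.mem_baseSet_trivializationAt' x)) w

theorem continuousLinearMapAt_chartTangent (x : M) (w : E) :
    (trivializationAt E (TangentSpace I) x).continuousLinearMapAt ℝ x (chartTangent I x w) = w := by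
  have := ((trivializationAt E (TangentSpace I) x).continuousLinearEquivAt ℝ x
    (FiberBundle.mem_baseSet_trivializationAt' x)).apply_symm_apply w
  have h2 := Trivialization.coe_continuousLinearEquivAt_eq (R := ℝ) (trivializationAt E (TangentSpace I) x)
     (FiberBundle.mem_baseSet_trivializationAt' x)
  exact (congrFun h2 _).symm.trans this

/-- The preferred chart at `x` induces the trivial coordinate change at `x` itself. The equation `w
= v` is read through the definitional identification of the tangent space with `E`. -/
theorem chartTangent_eq (x : M) (w : E) (v : TangentSpace I x) (h : w = v) :
    chartTangent I x w = v := by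
  rw [chartTangent_apply, TangentBundle.symmL_trivializationAt_eq_core (mem_chart_source H x)]
  subst h
  exact (tangentBundleCore I M).coordChange_self _ _ (mem_chart_source H x) _

variable [Bundle.RiemannianBundle (fun x : M => TangentSpace I x)]
  [IsContinuousRiemannianBundle E (fun x : M => TangentSpace I x)]

/-- By continuity of the metric, transporting vectors from `y` to `x` in the chart at `x` distorts
norms by a factor tending to 1. The next lemma is the transport in the other direction. -/
theorem eventually_norm_chartTangent_mfderiv_extChartAt_le (x : M) {r : ℝ} (hr : 1 < r) :
    ∀ᶠ y in 𝓝 x, ∀ (v : TangentSpace I y) (w : E),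
      mfderiv I 𝓘(ℝ, E) (extChartAt I x) y v = w → ‖chartTangent I x w‖ ≤ r * ‖v‖ := by
  have hx : (chartAt H x).source ∈ 𝓝 x := chart_source_mem_nhds H x
  filter_upwards [eventually_norm_symmL_trivializationAt_self_comp_lt E
    (fun x : M => TangentSpace I x) x hr, hx] with y hy h'y v w hw
  have h := (ContinuousLinearMap.le_of_opNorm_le _ hy.le v)
  rw [ContinuousLinearMap.comp_apply] at h
  rw [← TangentBundle.continuousLinearMapAt_trivializationAt h'y] at hw
  rw [chartTangent_apply, ← hw]
  exact h

theorem eventually_norm_mfderivWithin_extChartAt_symm_le (x : M) {r : ℝ} (hr : 1 < r) :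
    ∀ᶠ y in 𝓝 x, ∀ w : E,
      ‖(mfderivWithin 𝓘(ℝ, E) I (extChartAt I x).symm (range I) (extChartAt I x y) w)‖
        ≤ r * ‖chartTangent I x w‖ := by
  have hx : (chartAt H x).source ∈ 𝓝 x := chart_source_mem_nhds H x
  filter_upwards [eventually_norm_symmL_trivializationAt_comp_self_lt E
    (fun x : M => TangentSpace I x) x hr, hx] with y hy h'y w
  have h := (ContinuousLinearMap.le_of_opNorm_le _ hy.le (chartTangent I x w))
  have hw := continuousLinearMapAt_chartTangent I x w
  have A : (extChartAt I x).symm (extChartAt I x y) = y :=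
    (extChartAt I x).left_inv (by simpa using h'y)
  rw [ContinuousLinearMap.comp_apply, hw, TangentBundle.symmL_trivializationAt h'y] at h
  convert! h using 3; congr


variable [IsRiemannianManifold I M]

/-- The straight segment in the chart is a competitor for the distance, and its Riemannian length is
at most `r` times its length in the norm frozen at `x`. -/
theorem eventually_edist_le_norm_chartTangent (x : M) {r : ℝ≥0} (hr : 1 < r) :
    ∀ᶠ y in 𝓝 x, edist x y ≤ r * ‖chartTangent I x (extChartAt I x y - extChartAt I x x)‖ₑ := by
  have hD : ∀ᶠ z in 𝓝[range I] (extChartAt I x x), ∀ w : E,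
      ‖(mfderivWithin 𝓘(ℝ, E) I (extChartAt I x).symm (range I) z w)‖
        ≤ r * ‖chartTangent I x w‖ := by
    have hC := eventually_norm_mfderivWithin_extChartAt_symm_le I x (r := r) (by exact_mod_cast hr)
    have : 𝓝 x = 𝓝 ((extChartAt I x).symm (extChartAt I x x)) := by simp
    rw [this] at hC
    have : ContinuousAt (extChartAt I x).symm (extChartAt I x x) := continuousAt_extChartAt_symm _
    filter_upwards [nhdsWithin_le_nhds (this.eventually hC),
      extChartAt_target_mem_nhdsWithin x] with y hy h'y
    rw [(extChartAt I x).right_inv h'y] at hy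
    exact hy
  obtain ⟨ρ, ρ_pos, hρ⟩ : ∃ ρ > 0,
      Metric.ball (extChartAt I x x) ρ ∩ range I ⊆ (extChartAt I x).target ∩
        {z | ∀ w : E, ‖(mfderivWithin 𝓘(ℝ, E) I (extChartAt I x).symm (range I) z w)‖
        ≤ r * ‖chartTangent I x w‖} :=
    Metric.mem_nhdsWithin_iff.1 (inter_mem (extChartAt_target_mem_nhdsWithin x) hD)
  have A : (extChartAt I x) ⁻¹' (Metric.ball (extChartAt I x x) ρ ∩ range I) ∈ 𝓝 x := by
    apply extChartAt_preimage_mem_nhds_of_mem_nhdsWithin (by simp)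
    rw [inter_comm]
    exact inter_mem_nhdsWithin _ (Metric.ball_mem_nhds _ ρ_pos)
  filter_upwards [A, chart_source_mem_nhds H x] with y hy h'y
  let η := ContinuousAffineMap.lineMap (R := ℝ) (extChartAt I x x) (extChartAt I x y)
  set γ := (extChartAt I x).symm ∘ η
  have hη : Icc 0 1 ⊆ ⇑η ⁻¹' ((extChartAt I x).target ∩
        {z | ∀ w : E, ‖(mfderivWithin 𝓘(ℝ, E) I (extChartAt I x).symm (range I) z w)‖
        ≤ r * ‖chartTangent I x w‖}) := by
    simp only [← image_subset_iff, ContinuousAffineMap.coe_lineMap_eq,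
     ← segment_eq_image_lineMap, η]
    apply Subset.trans _ hρ
    exact ((convex_ball _ _).inter I.convex_range).segment_subset (by simp [ρ_pos]) hy
  simp only [preimage_inter, subset_inter_iff] at hη
  have η_smooth : ContMDiffOn 𝓘(ℝ, ℝ) 𝓘(ℝ, E) 1 η (Icc 0 1) := by
    apply ContMDiff.contMDiffOn
    rw [contMDiff_iff_contDiff]
    exact ContinuousAffineMap.contDiff _
  have : riemannianEDist I x y ≤ pathELength I γ 0 1 := by
    apply riemannianEDist_le_pathELength _ _ _ zero_le_one
    · exact (contMDiffOn_extChartAt_symm x).comp η_smooth hη.1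
    · simp [γ, η, ContinuousAffineMap.coe_lineMap_eq]
    · simp [γ, η, ContinuousAffineMap.coe_lineMap_eq, h'y]
  rw [IsRiemannianManifold.out (I := I) x y]
  apply this.trans
  rw [pathELength_eq_lintegral_mfderivWithin_Icc]
  calc _ ≤ ∫⁻ t in Icc (0:ℝ) 1, r * ‖chartTangent I x (extChartAt I x y - extChartAt I x x)‖ₑ := ?_
    _ = _ := by simp
  apply setLIntegral_mono' measurableSet_Icc (fun t ht ↦ ?_)
  have : mfderivWithin 𝓘(ℝ, ℝ) I γ (Icc 0 1) t =
      (mfderivWithin 𝓘(ℝ, E) I (extChartAt I x).symm (range I) (η t)) ∘L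
        (mfderivWithin 𝓘(ℝ, ℝ) 𝓘(ℝ, E) η (Icc 0 1) t) := by
    apply mfderivWithin_comp
    · exact mdifferentiableWithinAt_extChartAt_symm (hη.1 ht)
    · exact η_smooth.mdifferentiableOn one_ne_zero t ht
    · exact hη.1.trans (preimage_mono (extChartAt_target_subset_range x))
    · rw [uniqueMDiffWithinAt_iff_uniqueDiffWithinAt]
      exact uniqueDiffOn_Icc zero_lt_one t ht
  have : mfderivWithin 𝓘(ℝ, ℝ) I γ (Icc 0 1) t 1 =
      (mfderivWithin 𝓘(ℝ, E) I (extChartAt I x).symm (range I) (η t))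
       (mfderivWithin 𝓘(ℝ, ℝ) 𝓘(ℝ, E) η (Icc 0 1) t 1) := congr($this 1)
  rw [this]
  have key (a b : E) (t : ℝ) :
      b - a = fderiv ℝ (ContinuousAffineMap.lineMap (R := ℝ) a b) t 1 := by simp
  have h2 : (mfderivWithin 𝓘(ℝ, ℝ) 𝓘(ℝ, E) η (Icc 0 1) t 1 : E)
       = extChartAt I x y - extChartAt I x x := by
    rw [mfderivWithin_eq_fderivWithin, fderivWithin_eq_fderiv (uniqueDiffOn_Icc zero_lt_one _ ht)
    (ContinuousAffineMap.differentiableAt _)]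
    exact (key _ _ _).symm
  rw [h2, ← ofReal_norm, ← ofReal_norm]
  calc _ ≤ ENNReal.ofReal (r * ‖chartTangent I x (extChartAt I x y - extChartAt I x x)‖) :=
        ENNReal.ofReal_le_ofReal (hη.2 ht _)
    _ = _ := by rw [ENNReal.ofReal_mul r.coe_nonneg, ENNReal.ofReal_coe_nnreal]


/-- An almost minimizing path stays where the metric is nearly constant; its image in the chart,
measured in the norm frozen at `x`, is at most `r` times longer and joins the same endpoints. -/
theorem eventually_norm_chartTangent_le_edist (x : M) {r : ℝ≥0} (hr : 1 < r) :
    ∀ᶠ y in 𝓝 x, ‖chartTangent I x (extChartAt I x y - extChartAt I x x)‖ₑ ≤ r * edist x y := by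
  have hC := eventually_norm_chartTangent_mfderiv_extChartAt_le I x (r := r) (by exact_mod_cast hr)
  obtain ⟨c, c_pos, hc⟩ := setOfPred_riemannianEDist_lt_subset_nhds I
    (inter_mem hC (chart_source_mem_nhds H x))
  have hball : ∀ᶠ y in 𝓝 x, edist x y < c := by
    have := Metric.eball_mem_nhds x (ε := c) (by exact_mod_cast c_pos)
    filter_upwards [this] with y hy
    rw [edist_comm]; exact hy
  filter_upwards [hball] with y hy
  have hlt : ∀ L : ℝ≥0∞, edist x y < L → L ≤ c →
      ‖chartTangent I x (extChartAt I x y - extChartAt I x x)‖ₑ ≤ r * L := by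
    intro L hL hLc
    rw [IsRiemannianManifold.out (I := I) x y] at hL
    obtain ⟨γ, hγx, hγy, γ_smooth, hγ⟩ := exists_lt_of_riemannianEDist_lt hL
    -- Every initial piece of `γ` is shorter than `c`, so the path cannot leave the Riemannian ball
    -- of radius `c`.
    have hmem : ∀ t ∈ Icc (0:ℝ) 1, γ t ∈ {y : M | ∀ (v : TangentSpace I y) (w : E),
        mfderiv I 𝓘(ℝ, E) (extChartAt I x) y v = w → ‖chartTangent I x w‖ ≤ r * ‖v‖} ∩
        (chartAt H x).source := by
      intro t ht
      apply hc
      refine lt_of_le_of_lt ?_ (hγ.trans_le hLc)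
      refine (riemannianEDist_le_pathELength (a := 0) (b := t)
        (γ_smooth.mono (Icc_subset_Icc_right ht.2)) hγx rfl ht.1).trans ?_
      exact pathELength_mono le_rfl ht.2
    let γ' : ℝ → E := extChartAt I x ∘ γ
    have hγ' : ContMDiffOn 𝓘(ℝ, ℝ) 𝓘(ℝ, E) 1 γ' (Icc 0 1) :=
      contMDiffOn_extChartAt.comp (I' := I) (t := (chartAt H x).source)
        γ_smooth (fun t ht ↦ (hmem t ht).2)
    rw [contMDiffOn_iff_contDiffOn] at hγ'
    let Γ : ℝ → TangentSpace I x := fun t => chartTangent I x (γ' t)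
    have hΓ : ContDiffOn ℝ 1 Γ (Icc 0 1) :=
      (chartTangent I x : E →L[ℝ] TangentSpace I x).contDiff.comp_contDiffOn hγ'
    have h1 := enorm_sub_le_lintegral_derivWithin_Icc_of_contDiffOn_Icc hΓ zero_le_one
    have hΓ01 : Γ 1 - Γ 0 = chartTangent I x (extChartAt I x y - extChartAt I x x) := by
      have h0 : γ' 0 = extChartAt I x x := by simp only [γ', Function.comp_apply, hγx]
      have h1 : γ' 1 = extChartAt I x y := by simp only [γ', Function.comp_apply, hγy]
      rw [map_sub, ← h0, ← h1]
    rw [← hΓ01]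
    refine h1.trans ?_
    calc _ ≤ ∫⁻ t in Icc (0:ℝ) 1, r * ‖mfderivWithin 𝓘(ℝ, ℝ) I γ (Icc 0 1) t 1‖ₑ := ?_
      _ = r * pathELength I γ 0 1 := by
        rw [lintegral_const_mul' _ _ ENNReal.coe_ne_top, pathELength_eq_lintegral_mfderivWithin_Icc]
      _ ≤ r * L := by gcongr
    apply setLIntegral_mono' measurableSet_Icc (fun t ht ↦ ?_)
    have hU : UniqueDiffWithinAt ℝ (Icc (0:ℝ) 1) t := uniqueDiffOn_Icc zero_lt_one t ht
    have hd : HasDerivWithinAt γ' (derivWithin γ' (Icc 0 1) t) (Icc 0 1) t :=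
      (hγ'.differentiableOn one_ne_zero t ht).hasDerivWithinAt
    have hdΓ : derivWithin Γ (Icc 0 1) t = chartTangent I x (derivWithin γ' (Icc 0 1) t) :=
      ((chartTangent I x : E →L[ℝ] TangentSpace I x).hasFDerivAt.comp_hasDerivWithinAt t hd).derivWithin hU
    rw [hdΓ]
    have hcomp : mfderivWithin 𝓘(ℝ, ℝ) 𝓘(ℝ, E) γ' (Icc 0 1) t =
        (mfderiv I 𝓘(ℝ, E) (extChartAt I x) (γ t)) ∘L (mfderivWithin 𝓘(ℝ, ℝ) I γ (Icc 0 1) t) := by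
      apply mfderiv_comp_mfderivWithin
      · exact mdifferentiableAt_extChartAt (hmem t ht).2
      · exact γ_smooth.mdifferentiableOn one_ne_zero _ ht
      · rw [uniqueMDiffWithinAt_iff_uniqueDiffWithinAt]
        exact hU
    have hcomp1 : mfderivWithin 𝓘(ℝ, ℝ) 𝓘(ℝ, E) γ' (Icc 0 1) t 1 =
        (mfderiv I 𝓘(ℝ, E) (extChartAt I x) (γ t)) (mfderivWithin 𝓘(ℝ, ℝ) I γ (Icc 0 1) t 1) :=
      congr($hcomp 1)
    have hfin := (hmem t ht).1 (mfderivWithin 𝓘(ℝ, ℝ) I γ (Icc 0 1) t 1)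
      (derivWithin γ' (Icc 0 1) t) (by
        rw [← hcomp1, mfderivWithin_eq_fderivWithin]; rfl)
    rw [← ofReal_norm, ← ofReal_norm, ← ENNReal.ofReal_coe_nnreal,
      ← ENNReal.ofReal_mul r.coe_nonneg]
    exact ENNReal.ofReal_le_ofReal hfin
  have hr0 : (r : ℝ≥0∞) ≠ 0 := by
    have : r ≠ 0 := (zero_lt_one.trans hr).ne'
    exact_mod_cast this
  rw [← ENNReal.div_le_iff' hr0 ENNReal.coe_ne_top]
  refine le_of_forall_gt_imp_ge_of_dense fun b hb => ?_
  refine (ENNReal.div_le_of_le_mul' (hlt (min b c) (lt_min hb hy) (min_le_right _ _))).trans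
    (min_le_left _ _)

/-- A map whose derivative at `x` expands the Riemannian norm does not decrease the distance
to `x`, locally. -/
theorem eventually_dist_le_dist_of_expanding {h : M → M} {x : M} (hh : MDifferentiableAt I I h x)
    {κ : ℝ} (hκ : 1 < κ) (hexp : ∀ v : TangentSpace I x, κ * ‖v‖ ≤ ‖mfderiv I I h x v‖) :
    ∀ᶠ y in 𝓝 x, dist y x ≤ dist (h y) (h x) := by
  -- One factor `r` is lost in each of the two distance comparisons, at `x` and at `h x`; hence the
  -- requirement `r ^ 2 < κ`.
  obtain ⟨r, hr1, hrκ⟩ : ∃ r : ℝ, 1 < r ∧ r < √κ := exists_between (by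
    rw [Real.lt_sqrt zero_le_one]; simpa using hκ)
  lift r to ℝ≥0 using by linarith
  have hr1' : 1 < r := by exact_mod_cast hr1
  have hr2 : (r : ℝ) ^ 2 < κ := (Real.lt_sqrt r.coe_nonneg).1 hrκ
  let A : E ≃L[ℝ] TangentSpace I x := chartTangent I x
  let B : E ≃L[ℝ] TangentSpace I (h x) := chartTangent I (h x)
  set C := ‖(A.symm : TangentSpace I x →L[ℝ] E)‖ with hC
  set C' := ‖(B : E →L[ℝ] TangentSpace I (h x))‖ with hC'
  have hC0 : 0 ≤ C := ContinuousLinearMap.opNorm_nonneg _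
  have hC0' : 0 ≤ C' := ContinuousLinearMap.opNorm_nonneg _
  have hA : ∀ w : E, ‖w‖ ≤ C * ‖A w‖ := fun w => by
    have := (A.symm : TangentSpace I x →L[ℝ] E).le_opNorm (A w)
    simpa using this
  have hB : ∀ w : E, ‖B w‖ ≤ C' * ‖w‖ := fun w =>
    (B : E →L[ℝ] TangentSpace I (h x)).le_opNorm w
  let F : E → E := writtenInExtChartAt I I x h
  let D : E →L[ℝ] E := mfderiv I I h x
  have hD : ∀ w : E, κ * ‖A w‖ ≤ ‖B (D w)‖ := by
    intro w
    have e1 : A w = (w : E) := chartTangent_eq I x w w rfl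
    have e2 : B (D w) = (D w : E) := chartTangent_eq I (h x) (D w) (D w) rfl
    rw [e1, e2]
    exact hexp w
  have hF : HasFDerivWithinAt F D (range I) (extChartAt I x x) := hh.hasMFDerivAt.2
  -- The linearization error, carried through the norm bounds `C` and `C'`, must stay below the
  -- surplus `κ - r ^ 2`; the `+ 1` keeps the denominator positive.
  have hε : 0 < (κ - r ^ 2) / (C * C' + 1) := by
    apply div_pos (by linarith) (by positivity)
  have hlo := hF.isLittleO.def hε
  have hlo' : ∀ᶠ y in 𝓝 x, ‖F (extChartAt I x y) - F (extChartAt I x x)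
      - D (extChartAt I x y - extChartAt I x x)‖ ≤
      (κ - r ^ 2) / (C * C' + 1) * ‖extChartAt I x y - extChartAt I x x‖ :=
    extChartAt_preimage_mem_nhds_of_mem_nhdsWithin (by simp) hlo
  have hFx : ∀ y ∈ (chartAt H x).source, F (extChartAt I x y) = extChartAt I (h x) (h y) := by
    intro y hy
    simp only [F, writtenInExtChartAt, Function.comp_apply]
    rw [(extChartAt I x).left_inv (by simpa using hy)]
  filter_upwards [hlo', chart_source_mem_nhds H x,
    eventually_edist_le_norm_chartTangent I x hr1',
    hh.continuousAt.eventually (eventually_norm_chartTangent_le_edist I (h x) hr1')]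
    with y h1 h2 h3 h4
  rw [hFx y h2, hFx x (mem_chart_source H x)] at h1
  set w := extChartAt I x y - extChartAt I x x with hw
  set w' := extChartAt I (h x) (h y) - extChartAt I (h x) (h x) with hw'
  have h3' : dist y x ≤ r * ‖A w‖ := by
    rw [edist_comm, edist_dist, ← ofReal_norm, ← ENNReal.ofReal_coe_nnreal,
      ← ENNReal.ofReal_mul r.coe_nonneg] at h3
    exact (ENNReal.ofReal_le_ofReal_iff (by positivity)).1 h3
  have h4' : ‖B w'‖ ≤ r * dist (h y) (h x) := by
    rw [edist_comm, edist_dist, ← ofReal_norm, ← ENNReal.ofReal_coe_nnreal,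
      ← ENNReal.ofReal_mul r.coe_nonneg] at h4
    exact (ENNReal.ofReal_le_ofReal_iff (by positivity)).1 h4
  have h5 : ‖B (D w)‖ ≤ ‖B w'‖ + ‖B (w' - D w)‖ := by
    have : B (D w) = B w' - B (w' - D w) := by rw [← map_sub]; congr 1; abel
    rw [this]
    exact norm_sub_le _ _
  have h6 : ‖B (w' - D w)‖ ≤ (κ - r ^ 2) * ‖A w‖ := by
    calc _ ≤ C' * ‖w' - D w‖ := hB _
      _ ≤ C' * ((κ - r ^ 2) / (C * C' + 1) * ‖w‖) := by gcongr
      _ ≤ C' * ((κ - r ^ 2) / (C * C' + 1) * (C * ‖A w‖)) := by gcongr; exact hA w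
      _ = (κ - r ^ 2) * ‖A w‖ * ((C * C') / (C * C' + 1)) := by ring
      _ ≤ (κ - r ^ 2) * ‖A w‖ * 1 := by
        have : 0 ≤ (κ - r ^ 2) * ‖A w‖ := mul_nonneg (by linarith) (norm_nonneg _)
        gcongr
        rw [div_le_one (by positivity)]
        linarith
      _ = _ := mul_one _
  have h7 := hD w
  have h8 : r ^ 2 * ‖A w‖ ≤ r * dist (h y) (h x) := by nlinarith
  have h9 : r * ‖A w‖ ≤ dist (h y) (h x) := by
    have : (r : ℝ) * (r * ‖A w‖) ≤ r * dist (h y) (h x) := by linarith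
    exact le_of_mul_le_mul_left this (by linarith)
  exact h3'.trans h9

end RiemannianComparison

/-! ### Conformality, the density point and the proportion of points returning at time p -/

section LocalMeasure

theorem measurable_birkhoffSum {M : Type*} [MeasurableSpace M] {f : M → M} (hf : Measurable f) {φ : M → ℝ} (hφ : Measurable φ)
    (k : ℕ) : Measurable (birkhoffSum f φ k) := by
  unfold birkhoffSum
  exact Finset.measurable_fun_sum _ fun i _ => hφ.comp (hf.iterate i)

/-- Conformality on all measurable subsets of `A` says that `m` on `f '' A` is the push-forward of
e^{-φ} m restricted to `A`. -/
theorem IsConformal.lintegral_image {M : Type*} [MeasurableSpace M] {f : M → M} (hf : Measurable f)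
    {φ : M → ℝ} (hφ : Measurable φ) {m : Measure M} (hm : IsConformal f φ m)
    {A : Set M} (hA : MeasurableSet A) (hinj : InjOn f A) {h : M → ℝ≥0∞} (hh : Measurable h) :
    ∫⁻ y in f '' A, h y ∂m = ∫⁻ x in A, ENNReal.ofReal (Real.exp (-φ x)) * h (f x) ∂m := by
  have hd : Measurable fun x => ENNReal.ofReal (Real.exp (-φ x)) := by fun_prop
  have hmap : m.restrict (f '' A) =
      ((m.restrict A).withDensity fun x => ENNReal.ofReal (Real.exp (-φ x))).map f := by
    ext B hB
    rw [Measure.restrict_apply hB, Measure.map_apply hf hB, withDensity_apply _ (hf hB),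
      Measure.restrict_restrict (hf hB), inter_comm B, ← image_inter_preimage, inter_comm A]
    exact hm.conformal _ ((hf hB).inter hA) (hinj.mono inter_subset_right)
  rw [hmap, lintegral_map hh hf, lintegral_withDensity_eq_lintegral_mul _ hd
    (g := fun x => h (f x)) (hh.comp hf)]
  rfl

theorem continuousAt_birkhoffSum {M : Type*} [TopologicalSpace M] {f : M → M} {φ : M → ℝ} (hφ : Continuous φ) {ζ : M} {p : ℕ}
    (hf : ∀ j < p, ContinuousAt f (f^[j] ζ)) : ContinuousAt (birkhoffSum f φ p) ζ := by
  have hit : ∀ j ≤ p, ContinuousAt f^[j] ζ := by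
    intro j
    induction j with
    | zero => exact fun _ => continuousAt_id
    | succ j ih =>
      intro hj
      rw [Function.iterate_succ']
      exact ContinuousAt.comp (hf j (by omega)) (ih (by omega))
  unfold birkhoffSum
  refine tendsto_finsetSum _ fun j hj => ?_
  exact hφ.continuousAt.comp (hit j (Finset.mem_range.1 hj).le)

variable {M : Type*} [MetricSpace M] [MeasurableSpace M]

theorem HasDensityAt.tendsto_sub {μ m : Measure M} [IsFiniteMeasure μ] [IsFiniteMeasure m]
    (hμm : μ ≪ m) {ζ : M} {c : ℝ} (h : HasDensityAt μ m ζ c) {A : ℝ → Set M}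
    (hA : ∀ r, A r ⊆ Metric.ball ζ r) :
    Tendsto (fun r => (μ.real (A r) - c * m.real (A r)) / m.real (Metric.ball ζ r))
      (𝓝[>] (0 : ℝ)) (𝓝 0) := by
  refine squeeze_zero_norm' (Eventually.of_forall fun r => ?_) h.2
  have hint : Integrable (fun x => (μ.rnDeriv m x).toReal - c) m :=
    Measure.integrable_toReal_rnDeriv.sub (integrable_const c)
  have h1 : μ.real (A r) - c * m.real (A r) = ∫ x in A r, ((μ.rnDeriv m x).toReal - c) ∂m := by
    rw [integral_sub Measure.integrable_toReal_rnDeriv.integrableOn (integrable_const c),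
      Measure.setIntegral_toReal_rnDeriv hμm, setIntegral_const, smul_eq_mul, mul_comm c]
  rw [h1, setAverage_eq, smul_eq_mul, norm_div, div_eq_inv_mul, Real.norm_of_nonneg measureReal_nonneg]
  gcongr
  calc _ ≤ ∫ x in A r, |(μ.rnDeriv m x).toReal - c| ∂m := norm_integral_le_integral_norm _
    _ ≤ _ := setIntegral_mono_set hint.abs.integrableOn (Eventually.of_forall fun x => abs_nonneg _)
      (LE.le.eventuallyLE (hA r))

variable [SecondCountableTopology M] [BorelSpace M]

/-- Lusin–Souslin on each piece of a compact exhaustion. It is what allows conformality to be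
applied again to `f '' A`. -/
theorem measurableSet_image_of_injOn [LocallyCompactSpace M] {f : M → M} (hf : Measurable f)
    {A : Set M} (hA : MeasurableSet A) (hinj : InjOn f A) : MeasurableSet (f '' A) := by
  have hcov : f '' A = ⋃ n, (f ∘ ((↑) : compactCovering M n → M)) '' ((↑) ⁻¹' A) := by
    ext y
    simp only [mem_image, mem_iUnion, mem_preimage, Function.comp_apply]
    constructor
    · rintro ⟨x, hx, rfl⟩
      obtain ⟨n, hn⟩ := exists_mem_compactCovering x
      exact ⟨n, ⟨x, hn⟩, hx, rfl⟩
    · rintro ⟨n, x, hx, rfl⟩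
      exact ⟨x, hx, rfl⟩
  rw [hcov]
  refine MeasurableSet.iUnion fun n => ?_
  have : CompactSpace (compactCovering M n) :=
    isCompact_iff_compactSpace.1 (isCompact_compactCovering M n)
  refine MeasurableSet.image_of_measurable_injOn (measurable_subtype_coe hA)
    (hf.comp measurable_subtype_coe) ?_
  intro x hx y hy hxy
  exact Subtype.ext (hinj hx hy hxy)

theorem IsConformal.iterate [LocallyCompactSpace M] {f : M → M} (hf : Measurable f)
    {φ : M → ℝ} (hφ : Measurable φ) {m : Measure M} (hm : IsConformal f φ m) (k : ℕ)
    {A : Set M} (hA : MeasurableSet A) (hinj : InjOn f^[k] A) :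
    m (f^[k] '' A) = ∫⁻ x in A, ENNReal.ofReal (Real.exp (-birkhoffSum f φ k x)) ∂m := by
  induction k generalizing A with
  | zero => simp
  | succ k ih =>
    have h1 : InjOn f A := fun x hx y hy hxy => hinj hx hy (by simp [hxy])
    have h2 : InjOn f^[k] (f '' A) := by
      rintro _ ⟨x, hx, rfl⟩ _ ⟨y, hy, rfl⟩ hxy
      rw [hinj hx hy hxy]
    have hmeas := measurable_birkhoffSum hf hφ k
    rw [Function.iterate_succ, image_comp, ih (measurableSet_image_of_injOn hf hA h1) h2,
      hm.lintegral_image hf hφ hA h1 (by fun_prop)]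
    refine lintegral_congr fun x => ?_
    rw [← ENNReal.ofReal_mul (Real.exp_nonneg _), ← Real.exp_add, birkhoffSum_succ']
    congr 2
    ring

/-- The points of the ball which return to it at time `p` are mapped bijectively onto the ball. -/
theorem eventually_measure_ball_eq_lintegral [LocallyCompactSpace M] {f : M → M} (hf : Measurable f)
    {φ : M → ℝ} (hφ : Measurable φ) {m : Measure M} (hm : IsConformal f φ m) {ζ : M} {p : ℕ}
    (hζ : f^[p] ζ = ζ) (he : ∃ e : OpenPartialHomeomorph M M, ζ ∈ e.source ∧ EqOn (f^[p]) e e.source)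
    (hexp : ∀ᶠ y in 𝓝 ζ, dist y ζ ≤ dist (f^[p] y) ζ) :
    ∀ᶠ r in 𝓝[>] (0 : ℝ), m (Metric.ball ζ r) =
      ∫⁻ x in Metric.ball ζ r ∩ f^[p] ⁻¹' Metric.ball ζ r,
        ENNReal.ofReal (Real.exp (-birkhoffSum f φ p x)) ∂m := by
  obtain ⟨e, heζ, heq⟩ := he
  have heζ' : e ζ = ζ := by rw [← heq heζ, hζ]
  have hsrc : e.source ∈ 𝓝 ζ := e.open_source.mem_nhds heζ
  have htgt : e.target ∈ 𝓝 ζ := by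
    have := e.map_source heζ
    rw [heζ'] at this
    exact e.open_target.mem_nhds this
  have hsymm : ContinuousAt e.symm ζ := by
    have := e.continuousAt_symm (mem_of_mem_nhds htgt)
    exact this
  have hsymmζ : e.symm ζ = ζ := by
    conv_lhs => rw [← heζ']
    exact e.left_inv heζ
  have hexp' : ∀ᶠ y in 𝓝 ζ, dist (e.symm y) ζ ≤ dist (f^[p] (e.symm y)) ζ := by
    have : Tendsto e.symm (𝓝 ζ) (𝓝 ζ) := by
      have := hsymm.tendsto
      rwa [hsymmζ] at this
    exact this.eventually hexp
  obtain ⟨r₀, hr₀, hball⟩ := Metric.eventually_nhds_iff_ball.1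
    ((eventually_mem_set.2 hsrc).and ((eventually_mem_set.2 htgt).and hexp'))
  filter_upwards [Ioo_mem_nhdsGT hr₀] with r hr
  have hsub : Metric.ball ζ r ⊆ Metric.ball ζ r₀ := Metric.ball_subset_ball hr.2.le
  have himg : f^[p] '' (Metric.ball ζ r ∩ f^[p] ⁻¹' Metric.ball ζ r) = Metric.ball ζ r := by
    apply Subset.antisymm
    · rintro _ ⟨x, hx, rfl⟩
      exact hx.2
    · intro y hy
      obtain ⟨-, hy2, hy3⟩ := hball y (hsub hy)
      have hfe : f^[p] (e.symm y) = y := by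
        rw [heq (e.map_target hy2), e.right_inv hy2]
      rw [hfe] at hy3
      -- Expansion enters here: the inverse branch sends `y` no farther from `ζ`, hence back into
      -- the ball.
      refine ⟨e.symm y, ⟨lt_of_le_of_lt hy3 hy, ?_⟩, hfe⟩
      rw [mem_preimage, hfe]; exact hy
  have hinj : InjOn f^[p] (Metric.ball ζ r ∩ f^[p] ⁻¹' Metric.ball ζ r) := by
    intro x hx y hy hxy
    have hx' := (hball x (hsub hx.1)).1
    have hy' := (hball y (hsub hy.1)).1
    rw [heq hx', heq hy'] at hxy
    exact e.injOn hx' hy' hxy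
  have := hm.iterate hf hφ p (Metric.isOpen_ball.measurableSet.inter
    ((hf.iterate p) Metric.isOpen_ball.measurableSet)) hinj
  rwa [himg] at this

/-- On a small ball the density e^{-S_pφ} lies within factors e^{±ε} of its value at `ζ`, so the
integral formula for m(B) pins the ratio. -/
theorem tendsto_conformal_return_ratio [LocallyCompactSpace M] {f : M → M} (hf : Measurable f)
    {φ : M → ℝ} (hφ : Measurable φ) {m : Measure M} (hm : IsConformal f φ m) {ζ : M} {p : ℕ}
    (hpos : ∀ r > 0, 0 < m (Metric.ball ζ r)) (hS : ContinuousAt (birkhoffSum f φ p) ζ)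
    (hζ : f^[p] ζ = ζ) (he : ∃ e : OpenPartialHomeomorph M M, ζ ∈ e.source ∧ EqOn (f^[p]) e e.source)
    (hexp : ∀ᶠ y in 𝓝 ζ, dist y ζ ≤ dist (f^[p] y) ζ) :
    Tendsto (fun r => m.real (Metric.ball ζ r ∩ f^[p] ⁻¹' Metric.ball ζ r)
        / m.real (Metric.ball ζ r)) (𝓝[>] (0 : ℝ)) (𝓝 (Real.exp (birkhoffSum f φ p ζ))) := by
  have := hm.prob
  set S := birkhoffSum f φ p ζ
  have hbound : ∀ ε > 0, ∀ᶠ r in 𝓝[>] (0 : ℝ),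
      m.real (Metric.ball ζ r ∩ f^[p] ⁻¹' Metric.ball ζ r) / m.real (Metric.ball ζ r)
        ∈ Icc (Real.exp (S - ε)) (Real.exp (S + ε)) := by
    intro ε hε
    obtain ⟨r₀, hr₀, hball⟩ := Metric.continuousAt_iff.1 hS ε hε
    filter_upwards [Ioo_mem_nhdsGT hr₀,
      eventually_measure_ball_eq_lintegral hf hφ hm hζ he hexp] with r hr heq
    set A := Metric.ball ζ r ∩ f^[p] ⁻¹' Metric.ball ζ r
    have hAm : MeasurableSet A := Metric.isOpen_ball.measurableSet.inter
      ((hf.iterate p) Metric.isOpen_ball.measurableSet)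
    have hdiff : ∀ x ∈ A, |birkhoffSum f φ p x - S| < ε := fun x hx =>
      hball (lt_trans hx.1 hr.2)
    have hB : 0 < m.real (Metric.ball ζ r) :=
      ENNReal.toReal_pos (hpos r hr.1).ne' (measure_ne_top _ _)
    have hup : m.real (Metric.ball ζ r) ≤ Real.exp (-(S - ε)) * m.real A := by
      have : m (Metric.ball ζ r) ≤ ENNReal.ofReal (Real.exp (-(S - ε))) * m A := by
        rw [heq, ← setLIntegral_const]
        refine setLIntegral_mono' hAm fun x hx => ?_
        refine ENNReal.ofReal_le_ofReal (Real.exp_le_exp.2 ?_)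
        have := (abs_lt.1 (hdiff x hx)).1
        linarith
      have := ENNReal.toReal_mono (by finiteness) this
      rwa [ENNReal.toReal_mul, ENNReal.toReal_ofReal (Real.exp_nonneg _)] at this
    have hlo : Real.exp (-(S + ε)) * m.real A ≤ m.real (Metric.ball ζ r) := by
      have : ENNReal.ofReal (Real.exp (-(S + ε))) * m A ≤ m (Metric.ball ζ r) := by
        rw [heq, ← setLIntegral_const]
        refine setLIntegral_mono' hAm fun x hx => ?_
        refine ENNReal.ofReal_le_ofReal (Real.exp_le_exp.2 ?_)
        have := (abs_lt.1 (hdiff x hx)).2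
        linarith
      have := ENNReal.toReal_mono (measure_ne_top _ _) this
      rwa [ENNReal.toReal_mul, ENNReal.toReal_ofReal (Real.exp_nonneg _)] at this
    constructor
    · rw [le_div_iff₀ hB]
      calc _ ≤ Real.exp (S - ε) * (Real.exp (-(S - ε)) * m.real A) := by gcongr
        _ = m.real A := by rw [← mul_assoc, ← Real.exp_add]; simp
    · rw [div_le_iff₀ hB]
      calc m.real A = Real.exp (S + ε) * (Real.exp (-(S + ε)) * m.real A) := by
            rw [← mul_assoc, ← Real.exp_add]; simp
        _ ≤ _ := by gcongr
  rw [tendsto_order]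
  constructor
  · intro a ha
    have : ∀ᶠ ε in 𝓝[>] (0 : ℝ), a < Real.exp (S - ε) := by
      have h : Tendsto (fun ε : ℝ => Real.exp (S - ε)) (𝓝[>] 0) (𝓝 (Real.exp (S - 0))) :=
        (Continuous.tendsto (by fun_prop) 0).mono_left nhdsWithin_le_nhds
      rw [sub_zero] at h
      exact h.eventually_const_lt ha
    obtain ⟨ε, h1, h2⟩ := (this.and self_mem_nhdsWithin).exists
    exact (hbound ε h2).mono fun r hr => h1.trans_le hr.1
  · intro a ha
    have : ∀ᶠ ε in 𝓝[>] (0 : ℝ), Real.exp (S + ε) < a := by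
      have h : Tendsto (fun ε : ℝ => Real.exp (S + ε)) (𝓝[>] 0) (𝓝 (Real.exp (S + 0))) :=
        (Continuous.tendsto (by fun_prop) 0).mono_left nhdsWithin_le_nhds
      rw [add_zero] at h
      exact h.eventually_lt_const ha
    obtain ⟨ε, h1, h2⟩ := (this.and self_mem_nhdsWithin).exists
    exact (hbound ε h2).mono fun r hr => hr.2.trans_lt h1

/-- Among the points of a small ball around `ζ`, the proportion of those returning to the ball at
time `p`. -/
theorem tendsto_return_ratio [LocallyCompactSpace M] {f : M → M} (hf : Measurable f)
    {φ : M → ℝ} (hφ : Measurable φ) {m μ : Measure M} [IsFiniteMeasure μ] (hm : IsConformal f φ m)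
    (hμm : μ ≪ m) {ζ : M} {p : ℕ} {c : ℝ} (hc : 0 < c) (hdens : HasDensityAt μ m ζ c)
    (hS : ContinuousAt (birkhoffSum f φ p) ζ)
    (hζ : f^[p] ζ = ζ) (he : ∃ e : OpenPartialHomeomorph M M, ζ ∈ e.source ∧ EqOn (f^[p]) e e.source)
    (hexp : ∀ᶠ y in 𝓝 ζ, dist y ζ ≤ dist (f^[p] y) ζ) :
    Tendsto (fun r => μ.real (Metric.ball ζ r ∩ f^[p] ⁻¹' Metric.ball ζ r)
        / μ.real (Metric.ball ζ r)) (𝓝[>] (0 : ℝ)) (𝓝 (Real.exp (birkhoffSum f φ p ζ))) ∧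
      ∀ r > 0, 0 < μ.real (Metric.ball ζ r) := by
  have := hm.prob
  have hmpos : ∀ r > 0, 0 < m.real (Metric.ball ζ r) := fun r hr =>
    ENNReal.toReal_pos (hdens.1 r hr).ne' (measure_ne_top _ _)
  have h1 := hdens.tendsto_sub hμm (A := fun r => Metric.ball ζ r ∩ f^[p] ⁻¹' Metric.ball ζ r)
    (fun r => inter_subset_left)
  have h2 := hdens.tendsto_sub hμm (A := fun r => Metric.ball ζ r)
    (fun r => Subset.rfl)
  have h3 := tendsto_conformal_return_ratio hf hφ hm hdens.1 hS hζ he hexp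
  have h4 : Tendsto (fun r => μ.real (Metric.ball ζ r) / m.real (Metric.ball ζ r))
      (𝓝[>] (0 : ℝ)) (𝓝 c) := by
    have := h2.add_const c
    rw [zero_add] at this
    refine this.congr' ?_
    filter_upwards [self_mem_nhdsWithin] with r hr
    have := hmpos r hr
    field_simp
    ring
  have h5 : Tendsto (fun r => μ.real (Metric.ball ζ r ∩ f^[p] ⁻¹' Metric.ball ζ r)
      / m.real (Metric.ball ζ r)) (𝓝[>] (0 : ℝ)) (𝓝 (c * Real.exp (birkhoffSum f φ p ζ))) := by
    have := h1.add (h3.const_mul c)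
    rw [zero_add] at this
    refine this.congr' ?_
    filter_upwards [self_mem_nhdsWithin] with r hr
    have := hmpos r hr
    field_simp
    ring
  constructor
  · have := h5.div h4 hc.ne'
    rw [mul_div_cancel_left₀ _ hc.ne'] at this
    refine this.congr' ?_
    filter_upwards [self_mem_nhdsWithin] with r hr
    have := hmpos r hr
    simp only [Pi.div_apply]
    rw [div_div_div_cancel_right₀ this.ne']
  · intro r hr
    obtain ⟨r', h6, h7⟩ := ((h4.eventually_const_lt hc).and (Ioo_mem_nhdsGT hr)).exists
    have h8 : 0 < μ.real (Metric.ball ζ r') := by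
      by_contra hcon
      have : μ.real (Metric.ball ζ r') = 0 := le_antisymm (not_lt.1 hcon) measureReal_nonneg
      rw [this, zero_div] at h6
      exact lt_irrefl _ h6
    exact h8.trans_le (measureReal_mono (Metric.ball_subset_ball h7.2.le))

end LocalMeasure

/-! ### Avoiding a set over a time interval: one block and one gap -/

section Avoid

variable {M : Type*}

/-- The points whose orbit avoids `Q` between the times `s` and `s + ℓ - 1`. -/
def avoid (f : M → M) (Q : Set M) (s ℓ : ℕ) : Set M :=
  {x | ∀ i, s ≤ i → i < s + ℓ → f^[i] x ∉ Q}

variable {f : M → M} {Q : Set M}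

theorem avoid_zero_right (s : ℕ) : avoid f Q s 0 = univ := by
  ext x
  simp only [avoid, mem_ofPred_eq, mem_univ, iff_true]
  intro i h1 h2
  omega

theorem preimage_avoid (k s ℓ : ℕ) : f^[k] ⁻¹' avoid f Q s ℓ = avoid f Q (s + k) ℓ := by
  ext x
  simp only [avoid, mem_preimage, mem_ofPred_eq, ← Function.iterate_add_apply]
  constructor
  · intro h i h1 h2
    have := h (i - k) (by omega) (by omega)
    rwa [Nat.sub_add_cancel (by omega)] at this
  · intro h i h1 h2
    exact h (i + k) (by omega) (by omega)

theorem avoid_add (s a b : ℕ) : avoid f Q s (a + b) = avoid f Q s a ∩ avoid f Q (s + a) b := by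
  ext x
  simp only [avoid, mem_inter_iff, mem_ofPred_eq]
  constructor
  · exact fun h => ⟨fun i h1 h2 => h i h1 (by omega), fun i h1 h2 => h i (by omega) (by omega)⟩
  · rintro ⟨h, h'⟩ i h1 h2
    by_cases hi : i < s + a
    · exact h i h1 hi
    · exact h' i (by omega) (by omega)

theorem avoid_one (s : ℕ) : avoid f Q s 1 = f^[s] ⁻¹' Qᶜ := by
  ext x
  simp only [avoid, mem_preimage, mem_ofPred_eq, mem_compl_iff]
  constructor
  · exact fun h => h s le_rfl (by omega)
  · intro h i h1 h2
    obtain rfl : i = s := by omega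
    exact h

theorem avoid_succ (s a : ℕ) : avoid f Q s (a + 1) = avoid f Q s a \ f^[s + a] ⁻¹' Q := by
  rw [avoid_add, avoid_one]
  rfl

theorem avoid_subset_avoid (s : ℕ) {a b : ℕ} (h : a ≤ b) : avoid f Q s b ⊆ avoid f Q s a :=
  fun _ hx i h1 h2 => hx i h1 (by omega)

variable [MeasurableSpace M] {μ : Measure M}

theorem measurableSet_avoid (hf : Measurable f) (hQ : MeasurableSet Q) (s ℓ : ℕ) :
    MeasurableSet (avoid f Q s ℓ) := by
  induction ℓ with
  | zero => rw [avoid_zero_right]; exact MeasurableSet.univ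
  | succ ℓ ih => rw [avoid_succ]; exact ih.diff (hf.iterate _ hQ)

theorem measureReal_preimage_iterate (hf : MeasurePreserving f μ μ) (hQ : MeasurableSet Q) (k : ℕ) :
    μ.real (f^[k] ⁻¹' Q) = μ.real Q :=
  (hf.iterate k).measureReal_preimage hQ.nullMeasurableSet

theorem measureReal_avoid (hf : MeasurePreserving f μ μ) (hQ : MeasurableSet Q) (s ℓ : ℕ) :
    μ.real (avoid f Q s ℓ) = μ.real (avoid f Q 0 ℓ) := by
  rw [← measureReal_preimage_iterate hf (measurableSet_avoid hf.measurable hQ 0 ℓ) s,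
    preimage_avoid, zero_add]

variable [IsProbabilityMeasure μ]

theorem measureReal_inter_avoid_ge (hf : MeasurePreserving f μ μ) (hQ : MeasurableSet Q)
    (A : Set M) (s ℓ : ℕ) :
    μ.real A - ℓ * μ.real Q ≤ μ.real (A ∩ avoid f Q s ℓ) := by
  induction ℓ with
  | zero => simp [avoid_zero_right]
  | succ ℓ ih =>
    rw [avoid_succ, ← inter_sdiff_assoc]
    have h1 := measureReal_sdiff_add_inter (μ := μ) (s := A ∩ avoid f Q s ℓ)
      (hf.measurable.iterate (s + ℓ) hQ)
    have h2 : μ.real (A ∩ avoid f Q s ℓ ∩ f^[s + ℓ] ⁻¹' Q) ≤ μ.real Q := by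
      rw [← measureReal_preimage_iterate hf hQ (s + ℓ)]
      exact measureReal_mono inter_subset_right
    push_cast
    linarith

theorem measureReal_avoid_ge (hf : MeasurePreserving f μ μ) (hQ : MeasurableSet Q) (ℓ : ℕ) :
    1 - ℓ * μ.real Q ≤ μ.real (avoid f Q 0 ℓ) := by
  simpa using measureReal_inter_avoid_ge hf hQ univ 0 ℓ

/-- A hit at time `a` preceded by one at time `i` is a pair of hits at distance j = a - i;
invariance moves the first of them to time 0. -/
theorem measureReal_hit_inter_hit_le (hf : MeasurePreserving f μ μ) (hQ : MeasurableSet Q) (a : ℕ) :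
    μ.real (f^[a] ⁻¹' Q \ avoid f Q 0 a) ≤
      ∑ j ∈ Finset.Icc 1 a, μ.real (Q ∩ f^[j] ⁻¹' Q) := by
  have hsub : f^[a] ⁻¹' Q \ avoid f Q 0 a ⊆
      ⋃ j ∈ Finset.Icc 1 a, f^[a - j] ⁻¹' (Q ∩ f^[j] ⁻¹' Q) := by
    rintro x ⟨hx, hxa⟩
    simp only [avoid, mem_ofPred_eq, not_forall, not_not] at hxa
    obtain ⟨i, -, hi, hiQ⟩ := hxa
    simp only [mem_iUnion, exists_prop]
    refine ⟨a - i, by simp; omega, ?_⟩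
    have h1 : a - (a - i) = i := by omega
    rw [h1]
    refine ⟨hiQ, ?_⟩
    rw [mem_preimage, ← Function.iterate_add_apply, Nat.sub_add_cancel (by omega)]
    exact hx
  refine (measureReal_mono hsub (measure_ne_top _ _)).trans
    ((measureReal_biUnion_finset_le _ _).trans_eq ?_)
  refine Finset.sum_congr rfl fun j _ => ?_
  exact measureReal_preimage_iterate hf (hQ.inter (hf.measurable.iterate j hQ)) _

/-- The probability of some hit is the sum of the probabilities of the hits, up to repeated hits,
each of which costs at most `S`. The event `G` will be the avoidance of `Q` in the far future. -/
theorem measureReal_avoid_inter_bonferroni (hf : MeasurePreserving f μ μ) (hQ : MeasurableSet Q)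
    (G : Set M) {S : ℝ} {b : ℕ} (hS : ∑ j ∈ Finset.Icc 1 b, μ.real (Q ∩ f^[j] ⁻¹' Q) ≤ S) :
    ∀ a ≤ b, |μ.real G - μ.real (G ∩ avoid f Q 0 a) - ∑ i ∈ Finset.range a, μ.real (f^[i] ⁻¹' Q ∩ G)|
      ≤ a * S := by
  intro a
  induction a with
  | zero => simp [avoid_zero_right]
  | succ a ih =>
    intro ha
    have ih := ih (by omega)
    have hm := hf.measurable.iterate a hQ
    have h1 := measureReal_sdiff_add_inter (μ := μ) (s := G ∩ avoid f Q 0 a) hm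
    have h2 : μ.real (G ∩ avoid f Q 0 a ∩ f^[a] ⁻¹' Q) ≤ μ.real (f^[a] ⁻¹' Q ∩ G) :=
      measureReal_mono fun x hx => ⟨hx.2, hx.1.1⟩
    have h3 : μ.real (f^[a] ⁻¹' Q ∩ G) ≤
        μ.real (G ∩ avoid f Q 0 a ∩ f^[a] ⁻¹' Q) + μ.real (f^[a] ⁻¹' Q \ avoid f Q 0 a) := by
      refine (measureReal_mono ?_).trans (measureReal_union_le _ _)
      intro x hx
      by_cases h : x ∈ avoid f Q 0 a
      · exact Or.inl ⟨⟨hx.2, h⟩, hx.1⟩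
      · exact Or.inr ⟨hx.1, h⟩
    have h4 := measureReal_hit_inter_hit_le hf hQ a
    have h5 : ∑ j ∈ Finset.Icc 1 a, μ.real (Q ∩ f^[j] ⁻¹' Q) ≤ S :=
      le_trans (Finset.sum_le_sum_of_subset_of_nonneg (Finset.Icc_subset_Icc_right (by omega))
        fun _ _ _ => measureReal_nonneg) hS
    rw [avoid_succ, ← inter_sdiff_assoc, Finset.sum_range_succ, zero_add]
    push_cast
    rw [abs_le] at ih ⊢
    constructor <;> linarith [ih.1, ih.2]

/-- Splitting a block of length `b` and a gap of length `t` off the time interval. -/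
theorem measureReal_avoid_block (hf : MeasurePreserving f μ μ) (hQ : MeasurableSet Q)
    {b t N : ℕ} {γ S : ℝ} (hS : ∑ j ∈ Finset.Icc 1 b, μ.real (Q ∩ f^[j] ⁻¹' Q) ≤ S)
    (hγ : ∀ s ≥ t, |μ.real (Q ∩ avoid f Q s N) - μ.real Q * μ.real (avoid f Q 0 N)| ≤ γ) :
    |μ.real (avoid f Q 0 (b + t + N)) - (1 - b * μ.real Q) * μ.real (avoid f Q 0 N)|
      ≤ b * γ + b * S + t * μ.real Q := by
  set G := avoid f Q (b + t) N with hG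
  have hGm : MeasurableSet G := measurableSet_avoid hf.measurable hQ _ _
  have hμG : μ.real G = μ.real (avoid f Q 0 N) := measureReal_avoid hf hQ _ _
  have h1 : avoid f Q 0 (b + t + N) = (G ∩ avoid f Q 0 b) ∩ avoid f Q b t := by
    rw [avoid_add, avoid_add, zero_add, zero_add, inter_comm, ← inter_assoc]
  have h2 := measureReal_inter_avoid_ge hf hQ (G ∩ avoid f Q 0 b) b t
  have h3 : μ.real ((G ∩ avoid f Q 0 b) ∩ avoid f Q b t) ≤ μ.real (G ∩ avoid f Q 0 b) :=
    measureReal_mono inter_subset_left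
  have h4 := measureReal_avoid_inter_bonferroni hf hQ G hS b le_rfl
  have h5 : |∑ i ∈ Finset.range b, μ.real (f^[i] ⁻¹' Q ∩ G)
      - b * (μ.real Q * μ.real (avoid f Q 0 N))| ≤ b * γ := by
    have : (b : ℝ) * (μ.real Q * μ.real (avoid f Q 0 N)) =
        ∑ i ∈ Finset.range b, μ.real Q * μ.real (avoid f Q 0 N) := by simp
    rw [this, ← Finset.sum_sub_distrib]
    refine (Finset.abs_sum_le_sum_abs _ _).trans ?_
    have : (b : ℝ) * γ = ∑ i ∈ Finset.range b, γ := by simp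
    rw [this]
    refine Finset.sum_le_sum fun i hi => ?_
    have hi := Finset.mem_range.1 hi
    -- Seen from a hit at time `i < b`, the future event starts after at least `t` steps, so the
    -- mixing bound applies.
    have : f^[i] ⁻¹' Q ∩ G = f^[i] ⁻¹' (Q ∩ avoid f Q (b + t - i) N) := by
      rw [preimage_inter, preimage_avoid, Nat.sub_add_cancel (by omega)]
    rw [this, measureReal_preimage_iterate hf
      (hQ.inter (measurableSet_avoid hf.measurable hQ _ _))]
    exact hγ _ (by omega)
  rw [h1]
  rw [hμG] at h4
  rw [abs_le] at h4 h5 ⊢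
  constructor <;> linarith [h4.1, h4.2, h5.1, h5.2]

end Avoid

/-! ### Iterating an approximate factor 1 - x -/

section BlockLimit

/-- Replacing 1 - x by e^{-x} costs at most x² per step because `|w| ≤ 1`, and earlier errors are
multiplied by e^{-x} ≤ 1, so errors only add up. -/
theorem abs_sub_exp_le_of_block {w : ℕ → ℝ} {x ε : ℝ} {c : ℕ} (hx0 : 0 ≤ x) (hx1 : x ≤ 1)
    (hw0 : w 0 = 1) (hw : ∀ N, |w N| ≤ 1) (hstep : ∀ N, |w (c + N) - (1 - x) * w N| ≤ ε) (K : ℕ) :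
    |w (K * c) - Real.exp (-(K * x))| ≤ K * (ε + x ^ 2) := by
  induction K with
  | zero => simp [hw0]
  | succ K ih =>
    have h1 := hstep (K * c)
    have h2 : |Real.exp (-x) - 1 - (-x)| ≤ (-x) ^ 2 :=
      Real.abs_exp_sub_one_sub_id_le (by rw [abs_neg, abs_of_nonneg hx0]; exact hx1)
    have h3 : w ((K + 1) * c) - Real.exp (-((K + 1 : ℕ) * x)) =
        (w (c + K * c) - (1 - x) * w (K * c)) - (Real.exp (-x) - 1 - (-x)) * w (K * c)
          + Real.exp (-x) * (w (K * c) - Real.exp (-(K * x))) := by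
      have e1 : (K + 1) * c = c + K * c := by ring
      have e2 : Real.exp (-((K + 1 : ℕ) * x)) = Real.exp (-x) * Real.exp (-(K * x)) := by
        rw [← Real.exp_add]; congr 1; push_cast; ring
      rw [e1, e2]; ring
    have h4 : |(Real.exp (-x) - 1 - (-x)) * w (K * c)| ≤ x ^ 2 := by
      rw [abs_mul]
      calc _ ≤ (-x) ^ 2 * 1 := by gcongr; exact hw _
        _ = _ := by ring
    have h5 : |Real.exp (-x) * (w (K * c) - Real.exp (-(K * x)))| ≤ K * (ε + x ^ 2) := by
      rw [abs_mul, abs_of_pos (Real.exp_pos _)]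
      calc _ ≤ 1 * |w (K * c) - Real.exp (-(K * x))| := by
            gcongr
            exact Real.exp_le_one_iff.2 (by linarith)
        _ ≤ _ := by rw [one_mul]; exact ih
    rw [h3]
    push_cast
    refine (abs_add_le _ _).trans ?_
    have := abs_sub (w (c + K * c) - (1 - x) * w (K * c)) ((Real.exp (-x) - 1 - (-x)) * w (K * c))
    linarith

theorem tendsto_exp_of_block {ι : Type*} {l : Filter ι} {w : ι → ℕ → ℝ} {x ε : ι → ℝ}
    {c K : ι → ℕ} {L : ℝ} (hx : ∀ i, 0 ≤ x i) (hw0 : ∀ i, w i 0 = 1) (hw : ∀ i N, |w i N| ≤ 1)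
    (hstep : ∀ᶠ i in l, ∀ N, |w i (c i + N) - (1 - x i) * w i N| ≤ ε i)
    (hx0 : Tendsto x l (𝓝 0)) (hKx : Tendsto (fun i => K i * x i) l (𝓝 L))
    (hKε : Tendsto (fun i => K i * ε i) l (𝓝 0)) :
    Tendsto (fun i => w i (K i * c i)) l (𝓝 (Real.exp (-L))) := by
  have h1 : Tendsto (fun i => Real.exp (-(K i * x i))) l (𝓝 (Real.exp (-L))) :=
    (Real.continuous_exp.tendsto _).comp hKx.neg
  have h2 : Tendsto (fun i => K i * ε i + (K i * x i) * x i) l (𝓝 0) := by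
    simpa using hKε.add (hKx.mul hx0)
  have h3 : Tendsto (fun i => w i (K i * c i) - Real.exp (-(K i * x i))) l (𝓝 0) := by
    refine squeeze_zero_norm' ?_ h2
    filter_upwards [hstep, hx0.eventually_le_const zero_lt_one] with i hi hi1
    refine (abs_sub_exp_le_of_block (hx i) hi1 (hw0 i) (hw i) hi (K i)).trans_eq ?_
    ring
  simpa using h3.add h1

end BlockLimit

/-! ### The exponential law for avoiding shrinking, non-clustering sets -/

section ExtremeValueLaw

variable {M : Type*} [MeasurableSpace M] {μ : Measure M} [IsProbabilityMeasure μ] {f : M → M}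
  {ι : Type*} {l : Filter ι}

/-- Blocks of length b = n/k are separated by gaps of length `t`, so about N/(b+t) blocks fit. The
total error K(bγ + bS + tq) vanishes because Kb/n stays bounded, nγ and nS tend to 0, and Kt/n tends
to 0 while nq is bounded. -/
theorem tendsto_avoid_of_gap_pos (hf : MeasurePreserving f μ μ) {Q : ι → Set M}
    (hQ : ∀ᶠ i in l, MeasurableSet (Q i)) {n k t N : ι → ℕ} {γ : ι → ℝ} {L a : ℝ}
    (hn : Tendsto (fun i => (n i : ℝ)) l atTop)
    (hq : Tendsto (fun i => n i * μ.real (Q i)) l (𝓝 L))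
    (hγ : ∀ i, ∀ s ≥ t i, ∀ ℓ, |μ.real (Q i ∩ avoid f (Q i) s ℓ)
      - μ.real (Q i) * μ.real (avoid f (Q i) 0 ℓ)| ≤ γ i)
    (hγ0 : Tendsto (fun i => n i * γ i) l (𝓝 0))
    (hk : Tendsto (fun i => (k i : ℝ)) l atTop)
    (hkt : Tendsto (fun i => (k i * t i / n i : ℝ)) l (𝓝 0))
    (hS : Tendsto (fun i => n i * ∑ j ∈ Finset.Icc 1 (n i / k i),
      μ.real (Q i ∩ f^[j] ⁻¹' Q i)) l (𝓝 0))
    (hN : Tendsto (fun i => (N i / n i : ℝ)) l (𝓝 a)) (ht : ∀ᶠ i in l, 1 ≤ t i) :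
    Tendsto (fun i => μ.real (avoid f (Q i) 0 (N i))) l (𝓝 (Real.exp (-(a * L)))) := by
  set S : ι → ℝ := fun i => ∑ j ∈ Finset.Icc 1 (n i / k i), μ.real (Q i ∩ f^[j] ⁻¹' Q i) with hSdef
  set q : ι → ℝ := fun i => μ.real (Q i) with hqdef
  replace hS : Tendsto (fun i => n i * S i) l (𝓝 0) := hS
  replace hq : Tendsto (fun i => n i * q i) l (𝓝 L) := hq
  set b : ι → ℕ := fun i => n i / k i with hb
  set c : ι → ℕ := fun i => b i + t i with hc
  set K : ι → ℕ := fun i => N i / c i with hK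
  have hn0 : ∀ᶠ i in l, (0 : ℝ) < n i := hn.eventually_gt_atTop 0
  have hk0 : ∀ᶠ i in l, (0 : ℝ) < k i := hk.eventually_gt_atTop 0
  have hkinv : Tendsto (fun i => (k i : ℝ)⁻¹) l (𝓝 0) := tendsto_inv_atTop_zero.comp hk
  -- The bound `1 ≤ t` turns kt = o(n) into k = o(n), which makes the rounding in `n / k`
  -- negligible.
  have hkn : Tendsto (fun i => (k i / n i : ℝ)) l (𝓝 0) := by
    refine squeeze_zero' (Eventually.of_forall fun i => by positivity) ?_ hkt
    filter_upwards [ht] with i hi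
    have : (1 : ℝ) ≤ t i := by exact_mod_cast hi
    gcongr
    exact le_mul_of_one_le_right (Nat.cast_nonneg _) this
  have hbk : Tendsto (fun i => (b i * k i / n i : ℝ)) l (𝓝 1) := by
    refine tendsto_of_tendsto_of_tendsto_of_le_of_le' (g := fun i => 1 - (k i / n i : ℝ))
      (h := fun _ => 1) (by simpa using hkn.const_sub 1) tendsto_const_nhds ?_ ?_
    · filter_upwards [hn0, hk0] with i h1 h2
      have h2' : 0 < k i := by exact_mod_cast h2
      have h3 : n i ≤ b i * k i + k i := by
        have h4 := Nat.div_add_mod (n i) (k i)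
        have h5 := Nat.mod_lt (n i) h2'
        simp only [hb]
        rw [mul_comm (n i / k i)]
        omega
      have h3' : (n i : ℝ) ≤ b i * k i + k i := by exact_mod_cast h3
      rw [le_div_iff₀ h1, sub_mul, div_mul_cancel₀ _ h1.ne']
      linarith
    · filter_upwards [hn0] with i h1
      rw [div_le_one h1]
      exact_mod_cast Nat.div_mul_le_self _ _
  have hck : Tendsto (fun i => (c i * k i / n i : ℝ)) l (𝓝 1) := by
    have := hbk.add hkt
    rw [add_zero] at this
    refine this.congr fun i => ?_
    simp only [hc]
    push_cast
    ring
  have hcn : Tendsto (fun i => (c i / n i : ℝ)) l (𝓝 0) := by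
    have := hck.mul hkinv
    rw [mul_zero] at this
    refine this.congr' ?_
    filter_upwards [hk0] with i hi
    field_simp
  have hc0 : ∀ᶠ i in l, (0 : ℝ) < c i := by
    filter_upwards [ht] with i hi
    have : 0 < c i := by simp only [hc]; omega
    exact_mod_cast this
  have hKc : Tendsto (fun i => (K i * c i / n i : ℝ)) l (𝓝 a) := by
    refine tendsto_of_tendsto_of_tendsto_of_le_of_le' (g := fun i => (N i / n i - c i / n i : ℝ))
      (h := fun i => (N i / n i : ℝ)) (by simpa using hN.sub hcn) hN ?_ ?_
    · filter_upwards [hn0, hc0] with i h1 h2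
      have h2' : 0 < c i := by exact_mod_cast h2
      have h3 : N i ≤ K i * c i + c i := by
        have h4 := Nat.div_add_mod (N i) (c i)
        have h5 := Nat.mod_lt (N i) h2'
        simp only [hK]
        rw [mul_comm (N i / c i)]
        omega
      have h3' : (N i : ℝ) ≤ K i * c i + c i := by exact_mod_cast h3
      rw [← sub_div]
      gcongr
      linarith
    · filter_upwards [hn0] with i h1
      gcongr
      exact_mod_cast Nat.div_mul_le_self _ _
  have hKb : Tendsto (fun i => (K i * b i / n i : ℝ)) l (𝓝 a) := by
    have := hKc.mul (hbk.div hck one_ne_zero)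
    rw [div_one, mul_one] at this
    refine this.congr' ?_
    filter_upwards [hn0, hk0, hc0] with i h1 h2 h3
    simp only [Pi.div_apply]
    field_simp
  have hKt : Tendsto (fun i => (K i * t i / n i : ℝ)) l (𝓝 0) := by
    have := hKc.mul (hkt.div hck one_ne_zero)
    rw [div_one, mul_zero] at this
    refine this.congr' ?_
    filter_upwards [hn0, hk0, hc0] with i h1 h2 h3
    simp only [Pi.div_apply]
    field_simp
  have hbn : Tendsto (fun i => (b i / n i : ℝ)) l (𝓝 0) := by
    have := hbk.mul hkinv
    rw [mul_zero] at this
    refine this.congr' ?_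
    filter_upwards [hk0] with i hi
    field_simp
  have htn : Tendsto (fun i => (t i / n i : ℝ)) l (𝓝 0) := by
    have := hkt.mul hkinv
    rw [mul_zero] at this
    refine this.congr' ?_
    filter_upwards [hk0] with i hi
    field_simp
  set x : ι → ℝ := fun i => b i * q i with hx
  set ε : ι → ℝ := fun i => b i * γ i + b i * S i + t i * q i with hε
  have hx0 : Tendsto x l (𝓝 0) := by
    have := hbn.mul hq
    rw [zero_mul] at this
    refine this.congr' ?_
    filter_upwards [hn0] with i hi
    simp only [hx]
    field_simp
  have hKx : Tendsto (fun i => K i * x i) l (𝓝 (a * L)) := by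
    refine (hKb.mul hq).congr' ?_
    filter_upwards [hn0] with i hi
    simp only [hx]
    field_simp
  have hε0 : Tendsto ε l (𝓝 0) := by
    have := ((hbn.mul hγ0).add (hbn.mul hS)).add (htn.mul hq)
    simp only [zero_mul, add_zero] at this
    refine this.congr' ?_
    filter_upwards [hn0] with i hi
    simp only [hε]
    field_simp
  have hKε : Tendsto (fun i => K i * ε i) l (𝓝 0) := by
    have := ((hKb.mul hγ0).add (hKb.mul hS)).add (hKt.mul hq)
    simp only [mul_zero, zero_mul, add_zero] at this
    refine this.congr' ?_
    filter_upwards [hn0] with i hi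
    simp only [hε]
    field_simp
  let w : ι → ℕ → ℝ := fun i N => μ.real (avoid f (Q i) 0 N)
  have hxn : ∀ i, 0 ≤ x i := fun i => mul_nonneg (Nat.cast_nonneg _) measureReal_nonneg
  have hw0 : ∀ i, w i 0 = 1 := fun i => by simp [w, avoid_zero_right]
  have hw1 : ∀ i N, |w i N| ≤ 1 := fun i N => by
    rw [abs_of_nonneg measureReal_nonneg]; exact measureReal_le_one
  have hstep : ∀ᶠ i in l, ∀ N, |w i (c i + N) - (1 - x i) * w i N| ≤ ε i := by
    filter_upwards [hQ] with i hi N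
    exact measureReal_avoid_block hf hi le_rfl fun s hs => hγ i s hs N
  -- `N` lies between K and K + 1 complete blocks; both counts give the same limit.
  have hlim1 := tendsto_exp_of_block hxn hw0 hw1 hstep hx0 hKx hKε
  have hlim2 := tendsto_exp_of_block (K := fun i => K i + 1) (L := a * L) hxn hw0 hw1 hstep hx0
    (by simpa [add_mul] using hKx.add hx0) (by simpa [add_mul] using hKε.add hε0)
  refine tendsto_of_tendsto_of_tendsto_of_le_of_le' hlim2 hlim1 ?_ ?_
  · filter_upwards [hc0] with i hi
    have hi' : 0 < c i := by exact_mod_cast hi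
    refine measureReal_mono (avoid_subset_avoid 0 ?_)
    simp only [hK]
    rw [add_mul, one_mul, mul_comm]
    have h4 := Nat.div_add_mod (N i) (c i)
    have h5 := Nat.mod_lt (N i) hi'
    omega
  · filter_upwards with i
    exact measureReal_mono (avoid_subset_avoid 0 (Nat.div_mul_le_self _ _))

/-- Under mixing and anti-clustering conditions, the first entrance into shrinking sets is
asymptotically exponential. -/
theorem tendsto_avoid (hf : MeasurePreserving f μ μ) {Q : ι → Set M}
    (hQ : ∀ᶠ i in l, MeasurableSet (Q i)) {n k t N : ι → ℕ} {γ : ι → ℝ} {L a : ℝ}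
    (hn : Tendsto (fun i => (n i : ℝ)) l atTop)
    (hq : Tendsto (fun i => n i * μ.real (Q i)) l (𝓝 L))
    (hγ : ∀ i, ∀ s ≥ t i, ∀ ℓ, |μ.real (Q i ∩ avoid f (Q i) s ℓ)
      - μ.real (Q i) * μ.real (avoid f (Q i) 0 ℓ)| ≤ γ i)
    (hγ0 : Tendsto (fun i => n i * γ i) l (𝓝 0))
    (hk : Tendsto (fun i => (k i : ℝ)) l atTop)
    (hkt : Tendsto (fun i => (k i * t i / n i : ℝ)) l (𝓝 0))
    (hS : Tendsto (fun i => n i * ∑ j ∈ Finset.Icc 1 (n i / k i),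
      μ.real (Q i ∩ f^[j] ⁻¹' Q i)) l (𝓝 0))
    (hN : Tendsto (fun i => (N i / n i : ℝ)) l (𝓝 a)) :
    Tendsto (fun i => μ.real (avoid f (Q i) 0 (N i))) l (𝓝 (Real.exp (-(a * L)))) := by
  have hn0 : ∀ᶠ i in l, (0 : ℝ) < n i := hn.eventually_gt_atTop 0
  rcases eq_or_ne l ⊥ with rfl | hl
  · exact tendsto_bot
  have : l.NeBot := ⟨hl⟩
  have hL0 : 0 ≤ L := ge_of_tendsto' hq fun i => mul_nonneg (Nat.cast_nonneg _) measureReal_nonneg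
  rcases hL0.eq_or_lt with rfl | hL
  -- For L = 0 the union bound alone gives the limit 1.
  · have h1 := hN.mul hq
    rw [mul_zero] at h1 ⊢
    rw [neg_zero, Real.exp_zero]
    have h2 : Tendsto (fun i => 1 - N i / n i * (n i * μ.real (Q i))) l (𝓝 1) := by
      simpa using h1.const_sub 1
    refine tendsto_of_tendsto_of_tendsto_of_le_of_le' h2 tendsto_const_nhds ?_
      (Eventually.of_forall fun i => measureReal_le_one)
    filter_upwards [hn0, hQ] with i hi hQi
    have := measureReal_avoid_ge hf hQi (N i)
    have e : (N i : ℝ) / n i * (n i * μ.real (Q i)) = N i * μ.real (Q i) := by field_simp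
    rw [e]
    exact this
  · refine tendsto_avoid_of_gap_pos hf hQ hn hq hγ hγ0 hk hkt hS hN ?_
    have hq0 : Tendsto (fun i => μ.real (Q i)) l (𝓝 0) := by
      have := (tendsto_inv_atTop_zero.comp hn).mul hq
      rw [zero_mul] at this
      refine this.congr' ?_
      filter_upwards [hn0] with i hi
      simp only [Function.comp_apply]
      field_simp
    have h1 : Tendsto (fun i => n i * μ.real (Q i) * (1 - μ.real (Q i)) - n i * γ i) l (𝓝 L) := by
      simpa using (hq.mul (hq0.const_sub 1)).sub hγ0
    filter_upwards [h1.eventually_const_lt hL, hQ] with i hi hQi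
    by_contra hcon
    -- A zero gap contradicts mixing: with `ℓ = 1` it would compare the empty set Q ∩ Qᶜ with μ(Q)(1
    -- - μ(Q)), and n times the latter tends to L > 0.
    have ht0 : t i = 0 := by omega
    have h2 := hγ i 0 (by omega) 1
    rw [avoid_one, Function.iterate_zero, preimage_id, inter_compl_self, measureReal_empty,
      probReal_compl_eq_one_sub hQi, zero_sub, abs_neg] at h2
    have h3 := (le_abs_self _).trans h2
    have h4 : (n i : ℝ) * (μ.real (Q i) * (1 - μ.real (Q i))) ≤ n i * γ i := by gcongr
    linarith

end ExtremeValueLaw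

/-! ### From escapes to exceedances, and from hitting to returning -/

section Sets

variable {M : Type*} {f : M → M}

/-- A visit to `U` before time `N` without an escape repeats after `p` steps, and so on, until it
falls in the window [N, N + p), whose length is exactly one period. -/
theorem avoid_escape_inter_subset {U : Set M} {p : ℕ} (hp : 0 < p) (N : ℕ) :
    avoid f (U \ f^[p] ⁻¹' U) 0 N ∩ avoid f U N p ⊆ avoid f U 0 N := by
  rintro x ⟨h1, h2⟩
  have key : ∀ k i, i < N + p → N + p - i ≤ k → f^[i] x ∉ U := by
    intro k
    induction k with
    | zero => intro i hi hk; omega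
    | succ k ih =>
      intro i hi hk hiU
      by_cases hN : N ≤ i
      · exact h2 i hN hi hiU
      · refine h1 i (Nat.zero_le _) (by omega) ⟨hiU, ?_⟩
        rw [mem_preimage, ← Function.iterate_add_apply, add_comm]
        exact ih (i + p) (by omega) (by omega)
  intro i _ hi
  exact key _ i (by omega) le_rfl

theorem avoid_anti {U V : Set M} (h : U ⊆ V) (s ℓ : ℕ) : avoid f V s ℓ ⊆ avoid f U s ℓ :=
  fun _ hx i h1 h2 hi => hx i h1 h2 (h hi)

theorem notMem_avoid_iff {U : Set M} {s ℓ : ℕ} {x : M} :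
    x ∉ avoid f U s ℓ ↔ ∃ i, s ≤ i ∧ i < s + ℓ ∧ f^[i] x ∈ U := by
  simp [avoid]

variable [MeasurableSpace M] {μ : Measure M}

/-- The times counted are the j ≥ 1 with j < s/μ(A), that is j < ⌈s/μ(A)⌉, so there are ⌈s/μ(A)⌉ - 1
of them; truncated subtraction makes this 0 when the ceiling is 0. -/
theorem hitBefore_eq_compl_avoid [IsFiniteMeasure μ] {A : Set M} (hA : 0 < μ.real A) {s : ℝ} :
    hitBefore μ f A s = (avoid f A 1 (⌈s / μ.real A⌉₊ - 1))ᶜ := by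
  have hA' : μ A ≠ 0 := fun h => by simp [Measure.real, h] at hA
  have key : ∀ j : ℕ, ((j : ℝ≥0∞) < ENNReal.ofReal s / μ A) ↔ j < ⌈s / μ.real A⌉₊ := by
    intro j
    rw [Nat.lt_ceil, lt_div_iff₀ hA, ENNReal.lt_div_iff_mul_lt (Or.inl hA')
      (Or.inl (measure_ne_top _ _)), ← ENNReal.ofReal_toReal (measure_ne_top μ A),
      ← ENNReal.ofReal_natCast, ← ENNReal.ofReal_mul (Nat.cast_nonneg _)]
    exact ENNReal.ofReal_lt_ofReal_iff_of_nonneg (by positivity)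
  ext x
  rw [mem_compl_iff, notMem_avoid_iff]
  simp only [hitBefore, hittingTime, mem_ofPred_eq]
  constructor
  · intro h
    by_contra hcon
    push Not at hcon
    refine absurd h (not_lt.2 ?_)
    simp only [ENat.toENNReal_iInf, le_iInf_iff]
    intro j hj
    rw [ENat.toENNReal_coe, ← not_lt, key]
    intro hlt
    exact hcon j hj.1 (by omega) hj.2
  · rintro ⟨j, h1, h2, h3⟩
    have hj : (j : ℝ≥0∞) < ENNReal.ofReal s / μ A := (key j).2 (by omega)
    refine lt_of_le_of_lt ?_ hj
    rw [← ENat.toENNReal_coe]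
    exact ENat.toENNReal_le.2 (iInf₂_le j ⟨h1, h3⟩)

variable [IsProbabilityMeasure μ]

/-- A point avoiding `U` but not `V` visits `V \ U`; the bound is a union over the `N` times. -/
theorem abs_measureReal_avoid_sub_le_of_subset (hf : MeasurePreserving f μ μ) {U V : Set M}
    (hU : MeasurableSet U) (hV : MeasurableSet V) (h : U ⊆ V) (N : ℕ) :
    |μ.real (avoid f U 0 N) - μ.real (avoid f V 0 N)| ≤ N * |μ.real U - μ.real V| := by
  have h1 : μ.real (avoid f V 0 N) ≤ μ.real (avoid f U 0 N) := measureReal_mono (avoid_anti h 0 N)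
  have h2 := measureReal_inter_avoid_ge hf (hV.diff hU) (avoid f U 0 N) 0 N
  have h3 : avoid f U 0 N ∩ avoid f (V \ U) 0 N ⊆ avoid f V 0 N :=
    fun x hx i h1 h2 hi => hx.2 i h1 h2 ⟨hi, hx.1 i h1 h2⟩
  have h4 := measureReal_mono (μ := μ) h3
  rw [measureReal_sdiff h hU] at h2
  have h5 : μ.real U ≤ μ.real V := measureReal_mono h
  rw [abs_of_nonneg (by linarith), abs_of_nonpos (by linarith)]
  linarith

/-- Split the points avoiding `B` at times 1 to `k` according to their position at time 0. This
links return times to hitting times. The two lemmas that follow sum it over `h` steps, using that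
the left side decreases in `k`. -/
theorem measureReal_inter_avoid_eq_sub (hf : MeasurePreserving f μ μ) {B : Set M}
    (hB : MeasurableSet B) (k : ℕ) :
    μ.real (B ∩ avoid f B 1 k) = μ.real (avoid f B 0 k) - μ.real (avoid f B 0 (k + 1)) := by
  rw [add_comm k 1, avoid_add, avoid_one, ← measureReal_avoid hf hB 1 k, zero_add]
  have := measureReal_sdiff_add_inter (μ := μ) (s := avoid f B 1 k) hB
  have e : f^[0] ⁻¹' Bᶜ ∩ avoid f B 1 k = avoid f B 1 k \ B := by
    rw [Function.iterate_zero, preimage_id, inter_comm]; rfl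
  rw [e, inter_comm]
  linarith

theorem measureReal_avoid_sub_le (hf : MeasurePreserving f μ μ) {B : Set M}
    (hB : MeasurableSet B) (k h : ℕ) :
    μ.real (avoid f B 0 k) - μ.real (avoid f B 0 (k + h)) ≤ h * μ.real (B ∩ avoid f B 1 k) := by
  induction h with
  | zero => simp
  | succ h ih =>
    have h1 := measureReal_inter_avoid_eq_sub hf hB (k + h)
    have h2 : μ.real (B ∩ avoid f B 1 (k + h)) ≤ μ.real (B ∩ avoid f B 1 k) :=
      measureReal_mono (inter_subset_inter_right _ (avoid_subset_avoid 1 (by omega)))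
    push_cast
    rw [← add_assoc]
    linarith

theorem le_measureReal_avoid_sub (hf : MeasurePreserving f μ μ) {B : Set M}
    (hB : MeasurableSet B) (k h : ℕ) :
    h * μ.real (B ∩ avoid f B 1 (k + h)) ≤ μ.real (avoid f B 0 k) - μ.real (avoid f B 0 (k + h)) := by
  induction h with
  | zero => simp
  | succ h ih =>
    have h1 := measureReal_inter_avoid_eq_sub hf hB (k + h)
    have h2 : μ.real (B ∩ avoid f B 1 (k + (h + 1))) ≤ μ.real (B ∩ avoid f B 1 (k + h)) :=
      measureReal_mono (inter_subset_inter_right _ (avoid_subset_avoid 1 (by omega)))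
    have h3 : (h : ℝ) * μ.real (B ∩ avoid f B 1 (k + (h + 1))) ≤
      h * μ.real (B ∩ avoid f B 1 (k + h)) := by gcongr
    push_cast
    rw [← add_assoc] at *
    linarith

end Sets

/-! ### Limit laws for hitting and return times -/

section Limits

variable {M : Type*} [MeasurableSpace M] {μ : Measure M} [IsProbabilityMeasure μ] {f : M → M}

theorem tendsto_ceil_pred_mul {y : ℕ → ℝ} (hy : ∀ n, 0 < y n) (hy0 : Tendsto y atTop (𝓝 0))
    {s : ℝ} (hs : 0 ≤ s) :
    Tendsto (fun n => ((⌈s / y n⌉₊ - 1 : ℕ) : ℝ) * y n) atTop (𝓝 s) := by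
  refine tendsto_of_tendsto_of_tendsto_of_le_of_le (g := fun n => s - y n) (h := fun _ => s)
    (by simpa using hy0.const_sub s) tendsto_const_nhds (fun n => ?_) (fun n => ?_)
  · have h1 : s / y n ≤ ((⌈s / y n⌉₊ - 1 : ℕ) : ℝ) + 1 := by
      refine (Nat.le_ceil _).trans ?_
      have : ⌈s / y n⌉₊ ≤ ⌈s / y n⌉₊ - 1 + 1 := by omega
      exact_mod_cast this
    rw [div_le_iff₀ (hy n)] at h1
    simp only
    linarith
  · rw [← le_div_iff₀ (hy n)]
    have h0 : 0 ≤ s / y n := div_nonneg hs (hy n).le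
    rcases Nat.eq_zero_or_pos ⌈s / y n⌉₊ with h | h
    · simpa [h] using h0
    · have h2 := Nat.ceil_lt_add_one h0
      rw [Nat.cast_sub h]
      push_cast
      linarith

theorem tendsto_floor_mul {y : ℕ → ℝ} (hy : ∀ n, 0 < y n) (hy0 : Tendsto y atTop (𝓝 0))
    {s : ℝ} (hs : 0 ≤ s) :
    Tendsto (fun n => (⌊s / y n⌋₊ : ℝ) * y n) atTop (𝓝 s) := by
  refine tendsto_of_tendsto_of_tendsto_of_le_of_le (g := fun n => s - y n) (h := fun _ => s)
    (by simpa using hy0.const_sub s) tendsto_const_nhds (fun n => ?_) (fun n => ?_)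
  · have h1 := (Nat.lt_floor_add_one (s / y n)).le
    rw [div_le_iff₀ (hy n)] at h1
    simp only
    linarith
  · rw [← le_div_iff₀ (hy n)]
    exact Nat.floor_le (div_nonneg hs (hy n).le)

theorem tendsto_hitBefore {B : ℕ → Set M} (hf : MeasurePreserving f μ μ)
    (hB : ∀ n, MeasurableSet (B n)) (hpos : ∀ n, 0 < μ.real (B n))
    (hB0 : Tendsto (fun n => μ.real (B n)) atTop (𝓝 0)) {θ : ℝ}
    (hlaw : ∀ s : ℝ, ∀ N : ℕ → ℕ, Tendsto (fun n => N n * μ.real (B n)) atTop (𝓝 s) →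
      Tendsto (fun n => μ.real (avoid f (B n) 0 (N n))) atTop (𝓝 (Real.exp (-θ * s))))
    {s : ℝ} (hs : 0 ≤ s) :
    Tendsto (fun n => μ.real (hitBefore μ f (B n) s)) atTop (𝓝 (1 - Real.exp (-θ * s))) := by
  refine ((hlaw s _ (tendsto_ceil_pred_mul hpos hB0 hs)).const_sub 1).congr fun n => ?_
  rw [hitBefore_eq_compl_avoid (hpos n), probReal_compl_eq_one_sub
    (measurableSet_avoid hf.measurable (hB n) _ _), measureReal_avoid hf (hB n) 1]

/-- Convergence of the hitting times gives convergence of the return times. -/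
theorem tendsto_cond_hitBefore {B : ℕ → Set M} (hf : MeasurePreserving f μ μ)
    (hB : ∀ n, MeasurableSet (B n)) (hpos : ∀ n, 0 < μ.real (B n))
    (hB0 : Tendsto (fun n => μ.real (B n)) atTop (𝓝 0)) {θ : ℝ}
    (hlaw : ∀ s : ℝ, ∀ N : ℕ → ℕ, Tendsto (fun n => N n * μ.real (B n)) atTop (𝓝 s) →
      Tendsto (fun n => μ.real (avoid f (B n) 0 (N n))) atTop (𝓝 (Real.exp (-θ * s))))
    {s : ℝ} (hs : 0 < s) :
    Tendsto (fun n => (ProbabilityTheory.cond μ (B n)).real (hitBefore μ f (B n) s)) atTop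
      (𝓝 ((1 - θ) + θ * (1 - Real.exp (-θ * s)))) := by
  -- It suffices to find the conditional probability of no return up to `N n`, whose limit is minus
  -- the derivative of e^{-θs}.
  set N : ℕ → ℕ := fun n => ⌈s / μ.real (B n)⌉₊ - 1 with hN
  have hNs : Tendsto (fun n => (N n : ℝ) * μ.real (B n)) atTop (𝓝 s) :=
    tendsto_ceil_pred_mul hpos hB0 hs.le
  suffices h : Tendsto (fun n => μ.real (B n ∩ avoid f (B n) 1 (N n)) / μ.real (B n)) atTop
      (𝓝 (θ * Real.exp (-θ * s))) by
    have h1 := h.const_sub 1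
    have e : 1 - θ * Real.exp (-θ * s) = (1 - θ) + θ * (1 - Real.exp (-θ * s)) := by ring
    rw [e] at h1
    refine h1.congr fun n => ?_
    have hcond : ∀ A, (ProbabilityTheory.cond μ (B n)).real A
        = (μ.real (B n))⁻¹ * μ.real (B n ∩ A) := fun A => by
      simp only [Measure.real]
      rw [ProbabilityTheory.cond_apply (hB n), ENNReal.toReal_mul, ENNReal.toReal_inv]
    rw [hitBefore_eq_compl_avoid (hpos n), hcond]
    have h2 := measureReal_sdiff_add_inter (μ := μ) (s := B n)
      (measurableSet_avoid hf.measurable (hB n) 1 (N n))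
    have h3 := hpos n
    have h4 : μ.real (B n \ avoid f (B n) 1 (N n)) =
      μ.real (B n) - μ.real (B n ∩ avoid f (B n) 1 (N n)) := by linarith
    change _ = (μ.real (B n))⁻¹ * μ.real (B n \ avoid f (B n) 1 (N n))
    rw [h4]
    field_simp
  have hF := hlaw s N hNs
  have hder : HasDerivAt (fun s : ℝ => Real.exp (-θ * s)) (Real.exp (-θ * s) * (-θ * 1)) s :=
    ((hasDerivAt_id s).const_mul (-θ)).exp
  have hslope := hder.tendsto_slope_zero
  have hval : Real.exp (-θ * s) * (-θ * 1) = -(θ * Real.exp (-θ * s)) := by ring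
  rw [hval] at hslope
  have hfloor : ∀ ε > 0, Tendsto (fun n => (⌊ε / μ.real (B n)⌋₊ : ℝ) * μ.real (B n)) atTop (𝓝 ε) :=
    fun ε hε => tendsto_floor_mul hpos hB0 hε.le
  rw [tendsto_order]
  constructor
  · intro α hα
    -- Lower bound: the value at `N` dominates the average of the decreasing differences over the
    -- next ε/μ(B) steps, whose limit is a forward difference quotient of e^{-θs}.
    have hev : ∀ᶠ ε in 𝓝[>] (0 : ℝ),
        ε⁻¹ • (Real.exp (-θ * (s + ε)) - Real.exp (-θ * s)) < -α :=
      (hslope.mono_left (nhdsWithin_mono _ fun x hx => ne_of_gt hx)).eventually_lt_const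
        (by linarith)
    obtain ⟨ε, hε1, hε⟩ := (hev.and self_mem_nhdsWithin).exists
    replace hε : 0 < ε := hε
    set h : ℕ → ℕ := fun n => ⌊ε / μ.real (B n)⌋₊
    have hh : Tendsto (fun n => (h n : ℝ) * μ.real (B n)) atTop (𝓝 ε) := hfloor ε hε
    have hF2 := hlaw (s + ε) (fun n => N n + h n) (by
      refine (hNs.add hh).congr fun n => ?_
      push_cast; ring)
    have hlim := (hF.sub hF2).div hh hε.ne'
    have hgt : α < (Real.exp (-θ * s) - Real.exp (-θ * (s + ε))) / ε := by
      rw [smul_eq_mul] at hε1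
      have : (Real.exp (-θ * s) - Real.exp (-θ * (s + ε))) / ε =
        -(ε⁻¹ * (Real.exp (-θ * (s + ε)) - Real.exp (-θ * s))) := by ring
      rw [this]; linarith
    filter_upwards [hlim.eventually_const_lt hgt, hh.eventually_const_lt hε] with n h1 h2
    refine h1.trans_le ?_
    have h3 := measureReal_avoid_sub_le hf (hB n) (N n) (h n)
    simp only [Pi.div_apply]
    rw [div_le_div_iff₀ h2 (hpos n)]
    have h4 := hpos n
    nlinarith
  · intro α hα
    -- Upper bound: average over the preceding steps instead; `ε < s` ensures that there are enough
    -- of them.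
    have hev : ∀ᶠ ε in 𝓝[<] (0 : ℝ),
        -α < ε⁻¹ • (Real.exp (-θ * (s + ε)) - Real.exp (-θ * s)) :=
      (hslope.mono_left (nhdsWithin_mono _ fun x hx => ne_of_lt hx)).eventually_const_lt
        (by linarith)
    obtain ⟨ε', hε1, hε'⟩ := (hev.and (Ioo_mem_nhdsLT (neg_lt_zero.2 hs))).exists
    obtain ⟨ε, rfl⟩ : ∃ ε, ε' = -ε := ⟨-ε', by ring⟩
    have hε : 0 < ε := by linarith [hε'.2]
    have hεs : ε < s := by linarith [hε'.1]
    set h : ℕ → ℕ := fun n => ⌊ε / μ.real (B n)⌋₊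
    have hh : Tendsto (fun n => (h n : ℝ) * μ.real (B n)) atTop (𝓝 ε) := hfloor ε hε
    have hle : ∀ᶠ n in atTop, h n ≤ N n := by
      have := (hNs.sub hh).eventually_const_lt (sub_pos.2 hεs)
      filter_upwards [this] with n hn
      have h4 := hpos n
      have : (h n : ℝ) ≤ N n := by
        by_contra hcon
        push Not at hcon
        nlinarith
      exact_mod_cast this
    have hF2 := hlaw (s - ε) (fun n => N n - h n) (by
      refine (hNs.sub hh).congr' ?_
      filter_upwards [hle] with n hn
      rw [Nat.cast_sub hn]; ring)
    have hlim := (hF2.sub hF).div hh hε.ne'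
    have hlt : (Real.exp (-θ * (s - ε)) - Real.exp (-θ * s)) / ε < α := by
      rw [smul_eq_mul, ← sub_eq_add_neg] at hε1
      have : (Real.exp (-θ * (s - ε)) - Real.exp (-θ * s)) / ε =
        -((-ε)⁻¹ * (Real.exp (-θ * (s - ε)) - Real.exp (-θ * s))) := by
          rw [inv_neg]; ring
      rw [this]; linarith
    filter_upwards [hlim.eventually_lt_const hlt, hh.eventually_const_lt hε, hle] with n h1 h2 hn
    refine lt_of_le_of_lt ?_ h1
    have h3 := le_measureReal_avoid_sub hf (hB n) (N n - h n) (h n)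
    rw [Nat.sub_add_cancel hn] at h3
    simp only [Pi.div_apply]
    rw [div_le_div_iff₀ (hpos n) h2]
    have h4 := hpos n
    nlinarith

end Limits

/-! ### Exceedance sets are balls -/

section Exceedances

theorem escape_eq {M : Type*} (f : M → M) (X : M → EReal) (p : ℕ) (u : ℝ) :
    escape f X p u 0 = exceed f X u 0 \ f^[p] ⁻¹' exceed f X u 0 := by
  ext x
  simp [escape, exceed]

theorem escape_eq_preimage {M : Type*} (f : M → M) (X : M → EReal) (p : ℕ) (u : ℝ) (i : ℕ) :
    escape f X p u i = f^[i] ⁻¹' escape f X p u 0 := by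
  ext x
  simp only [escape, mem_ofPred_eq, mem_preimage, zero_add, ← Function.iterate_add_apply,
    add_comm p i]

theorem noEscape_eq_avoid {M : Type*} (f : M → M) (X : M → EReal) (p : ℕ) (u : ℝ) (s ℓ : ℕ) :
    noEscape f X p u s ℓ = avoid f (escape f X p u 0) s ℓ := by
  ext x
  simp only [noEscape, avoid, mem_ofPred_eq]
  refine forall₃_congr fun i _ _ => ?_
  rw [escape_eq_preimage, mem_preimage]

variable {M : Type*} [MetricSpace M] [MeasurableSpace M] {μ : Measure M} {ζ : M}

theorem ContinuousBallMeasure.tendsto (h : ContinuousBallMeasure μ ζ) :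
    Tendsto (fun η => μ.real (Metric.ball ζ η)) (𝓝[>] 0) (𝓝 0) := by
  obtain ⟨η₀, hη₀, hc⟩ := h
  have h1 := hc 0 ⟨le_rfl, hη₀⟩
  have h2 : Tendsto (fun η => μ.real (Metric.ball ζ η)) (𝓝[Ico 0 η₀] 0) (𝓝 0) := by
    simpa [ContinuousWithinAt] using h1
  refine h2.mono_left ?_
  rw [nhdsWithin_le_iff]
  exact mem_of_superset (Ioo_mem_nhdsGT hη₀) Ioo_subset_Ico_self

variable [IsFiniteMeasure μ]

/-- Exceedance sets of small positive measure are balls around `ζ`. -/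
theorem exists_exceed_eq_ball (hcont : ContinuousBallMeasure μ ζ)
    (hpos : ∀ r > 0, 0 < μ.real (Metric.ball ζ r)) {g : ℝ≥0 → EReal} (hg : IsPeakFunction g)
    (f : M → M) :
    ∃ η > 0, ∀ u : ℝ, 0 < μ.real (exceed f (observable μ ζ g) u 0) →
      μ.real (exceed f (observable μ ζ g) u 0) < η →
      ∃ R > 0, exceed f (observable μ ζ g) u 0 = Metric.ball ζ R := by
  have hlim := hcont.tendsto
  obtain ⟨η₀, hη₀, hc⟩ := hcont
  obtain ⟨v, hv, w, hw, hanti, hbij, hout⟩ := hg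
  have hv' : (0 : ℝ) < v := by exact_mod_cast hv
  obtain ⟨ρ, hρv, hρ0, hρη⟩ :=
    ((hlim.eventually_lt_const hv').and (Ioo_mem_nhdsGT hη₀)).exists
  refine ⟨μ.real (Metric.ball ζ ρ), hpos ρ hρ0, fun u hu0 huη => ?_⟩
  let y : M → ℝ≥0 := fun x => (μ (Metric.ball ζ (dist x ζ))).toNNReal
  have hy : ∀ x, (y x : ℝ) = μ.real (Metric.ball ζ (dist x ζ)) := fun x => rfl
  have hU : exceed f (observable μ ζ g) u 0 = {x | (u : EReal) < g (y x)} := rfl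
  rw [hU] at hu0 huη ⊢
  have hyball : ∀ x ∈ Metric.ball ζ ρ, (y x : ℝ) ≤ μ.real (Metric.ball ζ ρ) := fun x hx =>
    measureReal_mono (Metric.ball_subset_ball (le_of_lt hx))
  -- Small measure prevents the exceedance set from containing this ball; this forces `u` above `w`,
  -- into the range where `g` is invertible.
  have hnot : ¬ Metric.ball ζ ρ ⊆ {x | (u : EReal) < g (y x)} := fun hsub =>
    absurd (measureReal_mono (μ := μ) hsub) (not_le.2 huη)
  have hmem : ∀ z < v, g z ∈ Ioc w (g 0) := fun z hz => hbij.mapsTo hz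
  have hug : (u : EReal) < g 0 := by
    have hne : {x | (u : EReal) < g (y x)}.Nonempty := by
      by_contra hcon
      rw [not_nonempty_iff_eq_empty] at hcon
      rw [hcon, measureReal_empty] at hu0
      exact lt_irrefl _ hu0
    obtain ⟨x, hx⟩ := hne
    refine lt_of_lt_of_le hx ?_
    rcases lt_or_ge (y x) v with h | h
    · exact (hmem _ h).2
    · exact (hout _ h).trans hw.le
  have hwu : w < u := by
    by_contra hcon
    refine hnot fun x hx => ?_
    have : y x < v := by
      have := (hyball x hx).trans_lt hρv
      exact_mod_cast this
    exact lt_of_le_of_lt (not_lt.1 hcon) (hmem _ this).1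
  obtain ⟨z, hzv, hzu⟩ := hbij.surjOn ⟨hwu, hug.le⟩
  have hiff : ∀ x, (u : EReal) < g (y x) ↔ (y x : ℝ) < z := by
    intro x
    rw [NNReal.coe_lt_coe, ← hzu]
    rcases lt_or_ge (y x) v with h | h
    · exact hanti.lt_iff_gt hzv h
    · refine iff_of_false ?_ (not_lt.2 (le_of_lt (lt_of_lt_of_le hzv h)))
      rw [hzu]
      exact not_lt.2 ((hout _ h).trans hwu.le)
  have hz0 : (0 : ℝ) < z := by
    rw [NNReal.coe_pos, pos_iff_ne_zero]
    rintro rfl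
    exact hug.ne hzu.symm
  have hzρ : (z : ℝ) ≤ μ.real (Metric.ball ζ ρ) := by
    by_contra hcon
    exact hnot fun x hx => (hiff x).2 ((hyball x hx).trans_lt (not_le.1 hcon))
  -- The radius is the least one whose ball has measure at least `z`; continuity of the ball measure
  -- makes the set of candidates compact.
  let T : Set ℝ := Icc 0 ρ ∩ (fun r => μ.real (Metric.ball ζ r)) ⁻¹' Ici (z : ℝ)
  have hT : IsCompact T :=
    isCompact_Icc.of_isClosed_subset ((hc.mono (Icc_subset_Ico_right hρη)).preimage_isClosed_of_isClosed
      isClosed_Icc isClosed_Ici) inter_subset_left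
  obtain ⟨R, ⟨hRρ, hRz⟩, hRmin⟩ := hT.exists_isLeast ⟨ρ, ⟨hρ0.le, le_rfl⟩, hzρ⟩
  have hRz' : (z : ℝ) ≤ μ.real (Metric.ball ζ R) := hRz
  have hR0 : 0 < R := by
    refine hRρ.1.lt_of_ne ?_
    rintro rfl
    rw [Metric.ball_zero, measureReal_empty] at hRz'
    linarith
  refine ⟨R, hR0, ?_⟩
  ext x
  rw [mem_ofPred_eq, hiff, hy, Metric.mem_ball]
  constructor
  · intro h
    by_contra hcon
    exact absurd (measureReal_mono (μ := μ) (Metric.ball_subset_ball (not_lt.1 hcon)))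
      (not_le.2 (h.trans_le hRz'))
  · intro h
    by_contra hcon
    have := hRmin ⟨⟨dist_nonneg, (h.trans_le hRρ.2).le⟩, not_lt.1 hcon⟩
    linarith

end Exceedances

/-! ### The hitting law for balls of arbitrary radii -/

section HittingLaw

variable {M : Type*} [MetricSpace M] [MeasurableSpace M] {μ : Measure M}
  [IsProbabilityMeasure μ] {f : M → M} {ζ : M}

/-- The exceedance sets of levels with `n μ(X > u n) → τ` are eventually balls around `ζ`, with
radii tending to `0`. -/
theorem exists_radius_exceed (hcont : ContinuousBallMeasure μ ζ)
    (hpos : ∀ r > 0, 0 < μ.real (Metric.ball ζ r)) {g : ℝ≥0 → EReal} (hg : IsPeakFunction g)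
    (f : M → M) {τ : ℝ} (hτ : 0 < τ) {u : ℕ → ℝ}
    (hu : Tendsto (fun n : ℕ => (n : ℝ) * μ.real (exceed f (observable μ ζ g) (u n) 0))
      atTop (𝓝 τ)) :
    ∃ R : ℕ → ℝ, Tendsto R atTop (𝓝[>] 0) ∧
      ∀ᶠ n in atTop, exceed f (observable μ ζ g) (u n) 0 = Metric.ball ζ (R n) := by
  obtain ⟨η, hη, hball⟩ := exists_exceed_eq_ball hcont hpos hg f
  have hU0 : Tendsto (fun n : ℕ => μ.real (exceed f (observable μ ζ g) (u n) 0)) atTop (𝓝 0) := by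
    have := (tendsto_inv_atTop_zero.comp tendsto_natCast_atTop_atTop).mul hu
    rw [zero_mul] at this
    refine this.congr' ?_
    filter_upwards [eventually_gt_atTop 0] with n hn
    have : (0 : ℝ) < n := by exact_mod_cast hn
    simp only [Function.comp_apply]
    field_simp
  have hex : ∀ᶠ n in atTop, ∃ R > 0,
      exceed f (observable μ ζ g) (u n) 0 = Metric.ball ζ R := by
    filter_upwards [hu.eventually_const_lt hτ, hU0.eventually_lt_const hη] with n h1 h2
    refine hball (u n) ?_ h2
    exact pos_of_mul_pos_right h1 (Nat.cast_nonneg n)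
  have hch : ∀ n, ∃ R : ℝ, (∃ R > 0, exceed f (observable μ ζ g) (u n) 0 = Metric.ball ζ R) →
      0 < R ∧ exceed f (observable μ ζ g) (u n) 0 = Metric.ball ζ R := by
    intro n
    by_cases h : ∃ R > 0, exceed f (observable μ ζ g) (u n) 0 = Metric.ball ζ R
    · obtain ⟨R, h1, h2⟩ := h
      exact ⟨R, fun _ => ⟨h1, h2⟩⟩
    · exact ⟨0, fun h' => absurd h' h⟩
  choose R hR using hch
  have hRe : ∀ᶠ n in atTop, 0 < R n ∧
      exceed f (observable μ ζ g) (u n) 0 = Metric.ball ζ (R n) := by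
    filter_upwards [hex] with n hn using hR n hn
  refine ⟨R, ?_, hRe.mono fun n hn => hn.2⟩
  refine tendsto_nhdsWithin_iff.2 ⟨?_, hRe.mono fun n hn => hn.1⟩
  rw [tendsto_order]
  refine ⟨fun a ha => hRe.mono fun n hn => ha.trans hn.1, fun a ha => ?_⟩
  filter_upwards [hRe, hU0.eventually_lt_const (hpos a ha)] with n hn h2
  rw [hn.2] at h2
  by_contra hcon
  exact absurd (measureReal_mono (μ := μ) (Metric.ball_subset_ball (x := ζ) (not_lt.1 hcon)))
    (not_le.2 h2)

variable [BorelSpace M]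

theorem tendsto_escape (hf : MeasurePreserving f μ μ)
    (hpos : ∀ r > 0, 0 < μ.real (Metric.ball ζ r)) {X : M → EReal} {p : ℕ} {ρ τ : ℝ}
    (hratio : Tendsto (fun r => μ.real (Metric.ball ζ r ∩ f^[p] ⁻¹' Metric.ball ζ r)
        / μ.real (Metric.ball ζ r)) (𝓝[>] (0 : ℝ)) (𝓝 ρ)) {u : ℕ → ℝ}
    (hu : Tendsto (fun n : ℕ => (n : ℝ) * μ.real (exceed f X (u n) 0)) atTop (𝓝 τ))
    {R : ℕ → ℝ} (hR0 : Tendsto R atTop (𝓝[>] 0))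
    (hR : ∀ᶠ n in atTop, exceed f X (u n) 0 = Metric.ball ζ (R n)) :
    Tendsto (fun n : ℕ => (n : ℝ) * μ.real (escape f X p (u n) 0)) atTop (𝓝 ((1 - ρ) * τ)) := by
  have h1 := (hu.mul ((hratio.comp hR0).const_sub 1))
  rw [mul_comm τ] at h1
  refine h1.congr' ?_
  filter_upwards [hR, (tendsto_nhdsWithin_iff.1 hR0).2] with n hn hRn
  have h2 := measureReal_sdiff_add_inter (μ := μ) (s := Metric.ball ζ (R n))
    (hf.measurable.iterate p (Metric.isOpen_ball (x := ζ) (ε := R n)).measurableSet)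
  have h3 := hpos (R n) hRn
  rw [escape_eq, hn, Function.comp_apply]
  have h4 : μ.real (Metric.ball ζ (R n) \ f^[p] ⁻¹' Metric.ball ζ (R n)) = μ.real (Metric.ball ζ (R n))
    - μ.real (Metric.ball ζ (R n) ∩ f^[p] ⁻¹' Metric.ball ζ (R n)) := by linarith
  rw [h4]
  field_simp

/-- The hypotheses only concern the levels `u n`, so each ball of radius `δ j` borrows the level
whose exceedance set has nearly the same measure. -/
theorem tendsto_avoid_ball (hf : MeasurePreserving f μ μ)
    (hpos : ∀ r > 0, 0 < μ.real (Metric.ball ζ r)) {X : M → EReal} {p : ℕ} (hp : 0 < p) {θ τ : ℝ}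
    (hτ : 0 < τ) {u : ℕ → ℝ}
    (hu : Tendsto (fun n : ℕ => (n : ℝ) * μ.real (exceed f X (u n) 0)) atTop (𝓝 τ))
    (hq : Tendsto (fun n : ℕ => (n : ℝ) * μ.real (escape f X p (u n) 0)) atTop (𝓝 (θ * τ)))
    {R : ℕ → ℝ} (hR : ∀ᶠ n in atTop, exceed f X (u n) 0 = Metric.ball ζ (R n))
    {t : ℕ → ℕ} (hD : CondD μ f X p u t) (hD' : CondDPrime μ f X p u t)
    {δ : ℕ → ℝ} (hδ : ∀ n, 0 < δ n)
    (hδ0 : Tendsto (fun n => μ.real (Metric.ball ζ (δ n))) atTop (𝓝 0))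
    (s : ℝ) (N : ℕ → ℕ)
    (hN : Tendsto (fun n => N n * μ.real (Metric.ball ζ (δ n))) atTop (𝓝 s)) :
    Tendsto (fun n => μ.real (avoid f (Metric.ball ζ (δ n)) 0 (N n))) atTop
      (𝓝 (Real.exp (-θ * s))) := by
  obtain ⟨-, γ, hγanti, hγ0, hγ⟩ := hD
  obtain ⟨k, hk, hkt, hS⟩ := hD'
  set y : ℕ → ℝ := fun j => μ.real (Metric.ball ζ (δ j)) with hy
  have hy0 : ∀ j, 0 < y j := fun j => hpos _ (hδ j)
  -- With this index n_j y_j → τ, which is also the limit of n_j μ(U_j); hence μ(U_j)/y_j → 1.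
  set n : ℕ → ℕ := fun j => ⌊τ / y j⌋₊ with hn
  have hny : Tendsto (fun j => (n j : ℝ) * y j) atTop (𝓝 τ) := tendsto_floor_mul hy0 hδ0 hτ.le
  have hyinv : Tendsto (fun j => τ / y j) atTop atTop := by
    have : Tendsto y atTop (𝓝[>] 0) :=
      tendsto_nhdsWithin_iff.2 ⟨hδ0, Eventually.of_forall hy0⟩
    simpa [div_eq_mul_inv] using (tendsto_inv_nhdsGT_zero.comp this).const_mul_atTop hτ
  have hnt : Tendsto n atTop atTop := tendsto_nat_floor_atTop.comp hyinv
  have hntR : Tendsto (fun j => (n j : ℝ)) atTop atTop := tendsto_natCast_atTop_atTop.comp hnt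
  have hn0 : ∀ᶠ j in atTop, (0 : ℝ) < n j := hntR.eventually_gt_atTop 0
  have hRn := hnt.eventually hR
  have hun := hu.comp hnt
  have hNn : Tendsto (fun j => (N j / n j : ℝ)) atTop (𝓝 (s / τ)) := by
    refine (hN.div hny hτ.ne').congr fun j => ?_
    simp only [Pi.div_apply]
    rw [mul_div_mul_right _ _ (hy0 j).ne']
  let U : ℕ → Set M := fun j => exceed f X (u (n j)) 0
  let Q : ℕ → Set M := fun j => escape f X p (u (n j)) 0
  have hUm : ∀ᶠ j in atTop, MeasurableSet (U j) := by
    filter_upwards [hRn] with j hj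
    simp only [U]
    rw [hj]
    exact Metric.isOpen_ball.measurableSet
  have hQU : ∀ j, Q j = U j \ f^[p] ⁻¹' U j := fun j => escape_eq f X p (u (n j))
  have hQm : ∀ᶠ j in atTop, MeasurableSet (Q j) := by
    filter_upwards [hUm] with j hj
    rw [hQU]
    exact hj.diff (hf.measurable.iterate p hj)
  have hQlim : Tendsto (fun j => μ.real (avoid f (Q j) 0 (N j))) atTop
      (𝓝 (Real.exp (-(s / τ * (θ * τ))))) := by
    refine tendsto_avoid (n := n) (k := fun j => k (n j)) (t := fun j => t (n j))
      (γ := fun j => γ (n j) (t (n j))) hf hQm hntR (hq.comp hnt) ?_ (hγ0.comp hnt)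
      (tendsto_natCast_atTop_atTop.comp (hk.comp hnt)) ?_ ?_ hNn
    · intro j r hr ℓ
      have := hγ ℓ r (n j)
      rw [noEscape_eq_avoid, noEscape_eq_avoid] at this
      exact this.trans (hγanti _ hr)
    · exact hkt.tendsto_div_nhds_zero.comp hnt
    · refine (hS.comp hnt).congr fun j => ?_
      simp only [Function.comp_apply]
      congr 1
      refine Finset.sum_congr rfl fun i _ => ?_
      rw [escape_eq_preimage f X p (u (n j)) i]
  have hexpo : -(s / τ * (θ * τ)) = -θ * s := by field_simp
  rw [hexpo] at hQlim
  have hU0 : Tendsto (fun j => μ.real (U j)) atTop (𝓝 0) := by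
    have := (tendsto_inv_atTop_zero.comp hntR).mul hun
    rw [zero_mul] at this
    refine this.congr' ?_
    filter_upwards [hn0] with j hj
    simp only [Function.comp_apply, U]
    field_simp
  have hUlim : Tendsto (fun j => μ.real (avoid f (U j) 0 (N j))) atTop
      (𝓝 (Real.exp (-θ * s))) := by
    refine tendsto_of_tendsto_of_tendsto_of_le_of_le'
      (g := fun j => μ.real (avoid f (Q j) 0 (N j)) - p * μ.real (U j))
      (by simpa using hQlim.sub (hU0.const_mul (p : ℝ))) hQlim ?_ ?_
    · filter_upwards [hUm] with j hj
      refine (measureReal_inter_avoid_ge hf hj _ (N j) p).trans (measureReal_mono ?_)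
      rw [hQU]
      exact avoid_escape_inter_subset hp (N j)
    · filter_upwards with j
      refine measureReal_mono (avoid_anti ?_ 0 _)
      rw [hQU]
      exact sdiff_subset
  have hdiff : Tendsto (fun j => μ.real (avoid f (Metric.ball ζ (δ j)) 0 (N j))
      - μ.real (avoid f (U j) 0 (N j))) atTop (𝓝 0) := by
    have hr : Tendsto (fun j => N j * y j * |1 - n j * μ.real (U j) / (n j * y j)|) atTop (𝓝 0) := by
      have := hN.mul ((hun.div hny hτ.ne').const_sub 1).abs
      rw [div_self hτ.ne', sub_self, abs_zero, mul_zero] at this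
      exact this
    refine squeeze_zero_norm' ?_ hr
    filter_upwards [hRn, hn0] with j hj hnj
    have hb : |μ.real (avoid f (Metric.ball ζ (δ j)) 0 (N j)) - μ.real (avoid f (U j) 0 (N j))|
        ≤ N j * |y j - μ.real (U j)| := by
      simp only [U, hj]
      -- Both sets are balls centred at `ζ`, hence nested, so the difference of their measures
      -- controls the symmetric difference.
      rcases le_total (δ j) (R (n j)) with h | h
      · exact abs_measureReal_avoid_sub_le_of_subset hf Metric.isOpen_ball.measurableSet
          Metric.isOpen_ball.measurableSet (Metric.ball_subset_ball h) _
      · rw [abs_sub_comm, abs_sub_comm (y j)]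
        exact abs_measureReal_avoid_sub_le_of_subset hf Metric.isOpen_ball.measurableSet
          Metric.isOpen_ball.measurableSet (Metric.ball_subset_ball h) _
    rw [Real.norm_eq_abs]
    refine hb.trans_eq ?_
    rw [mul_assoc]
    congr 1
    have hyj := hy0 j
    have e : y j - μ.real (U j) = y j * (1 - n j * μ.real (U j) / (n j * y j)) := by field_simp
    rw [e, abs_mul, abs_of_pos hyj]
  simpa using hdiff.add hUlim

end HittingLaw

/-! ### Differentiability of iterates, and the assembly of the proof -/

section Iterate

variable {E : Type*} [NormedAddCommGroup E] [NormedSpace ℝ E]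
  {H : Type*} [TopologicalSpace H] {I : ModelWithCorners ℝ E H}
  {M : Type*} [TopologicalSpace M] [ChartedSpace H M]

theorem mdifferentiableAt_iterate {f : M → M} {x : M} {p : ℕ}
    (h : ∀ j < p, MDifferentiableAt I I f (f^[j] x)) : MDifferentiableAt I I f^[p] x := by
  induction p with
  | zero => exact mdifferentiableAt_id
  | succ p ih =>
    rw [Function.iterate_succ']
    exact (h p (by omega)).comp x (ih fun j hj => h j (by omega))

end Iterate

end EquilibriumHTS

theorem corollary3p4
    {E : Type*} [NormedAddCommGroup E] [NormedSpace ℝ E] [FiniteDimensional ℝ E]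
    {H : Type*} [TopologicalSpace H] (I : ModelWithCorners ℝ E H)
    {M : Type*} [MetricSpace M] [SecondCountableTopology M]
    [ChartedSpace H M] [IsManifold I 1 M]
    [Bundle.RiemannianBundle (fun x : M => TangentSpace I x)]
    [IsContinuousRiemannianBundle E (fun x : M => TangentSpace I x)]
    [IsRiemannianManifold I M]
    [MeasurableSpace M] [BorelSpace M]
    (f : M → M) (hf : Measurable f)
    (φ : M → ℝ) (hφ : Continuous φ) (hP : pressure f φ = 0)
    (m μ : Measure M) (hm : IsConformal f φ m)
    (hμ : IsEquilibriumState f φ μ) (hμm : μ ≪ m)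
    (ζ : M) (p : ℕ) (hζ : IsRepellingPeriodicPoint I f ζ p)
    (c : ℝ) (hc : 0 < c) (hdens : HasDensityAt μ m ζ c)
    (hcont : ContinuousBallMeasure μ ζ)
    (g : ℝ≥0 → EReal) (hg : IsPeakFunction g)
    (hdist : SummableDistortion μ f φ (observable μ ζ g) p ζ)
    (τ : ℝ) (hτ : 0 < τ) (u : ℕ → ℝ)
    (hu : Tendsto (fun n : ℕ => (n : ℝ) * μ.real (exceed f (observable μ ζ g) (u n) 0))
      atTop (𝓝 τ))
    (t : ℕ → ℕ)
    (hD : CondD μ f (observable μ ζ g) p u t)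
    (hD' : CondDPrime μ f (observable μ ζ g) p u t)
    (θ : ℝ) (hθ : θ = 1 - Real.exp (birkhoffSum f φ p ζ))
    (δ : ℕ → ℝ) (hδ : ∀ n, 0 < δ n) (hδ0 : Tendsto δ atTop (𝓝 0)) :
    (∀ s : ℝ, 0 ≤ s →
      Tendsto (fun n => μ.real (hitBefore μ f (Metric.ball ζ (δ n)) s))
        atTop (𝓝 (1 - Real.exp (-θ * s)))) ∧
    (∀ s : ℝ, 0 < s →
      Tendsto (fun n => (ProbabilityTheory.cond μ (Metric.ball ζ (δ n))).real
          (hitBefore μ f (Metric.ball ζ (δ n)) s))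
        atTop (𝓝 ((1 - θ) + θ * (1 - Real.exp (-θ * s))))) := by
  have := hμ.prob
  have hinv := hμ.invariant
  have : LocallyCompactSpace H := I.locallyCompactSpace
  have : LocallyCompactSpace M := ChartedSpace.locallyCompactSpace H M
  have hper : f^[p] ζ = ζ := by
    rw [← hζ.period]
    exact Function.iterate_minimalPeriod
  obtain ⟨κ, hκ, hexp⟩ := hζ.expanding
  have hexp' : ∀ᶠ y in 𝓝 ζ, dist y ζ ≤ dist (f^[p] y) ζ := by
    have := eventually_dist_le_dist_of_expanding I (mdifferentiableAt_iterate hζ.differentiable)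
      hκ hexp
    rwa [hper] at this
  have hS : ContinuousAt (birkhoffSum f φ p) ζ :=
    continuousAt_birkhoffSum hφ fun j hj => (hζ.differentiable j hj).continuousAt
  obtain ⟨hratio, hpos⟩ := tendsto_return_ratio hf hφ.measurable hm hμm hc hdens hS hper
    hζ.localInverse hexp'
  obtain ⟨R, hR0, hR⟩ := exists_radius_exceed hcont hpos hg f hτ hu
  have hq := tendsto_escape hinv hpos hratio hu hR0 hR
  rw [← hθ] at hq
  have hball0 : Tendsto (fun n => μ.real (Metric.ball ζ (δ n))) atTop (𝓝 0) :=
    hcont.tendsto.comp (tendsto_nhdsWithin_iff.2 ⟨hδ0, Eventually.of_forall hδ⟩)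
  have hlaw := tendsto_avoid_ball hinv hpos hζ.pos hτ hu hq hR hD hD' hδ hball0
  exact ⟨fun s hs => tendsto_hitBefore hinv (fun n => Metric.isOpen_ball.measurableSet)
      (fun n => hpos _ (hδ n)) hball0 hlaw hs,
    fun s hs => tendsto_cond_hitBefore hinv (fun n => Metric.isOpen_ball.measurableSet)
      (fun n => hpos _ (hδ n)) hball0 hlaw hs⟩
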